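/- For a finite graph $G=(V,E)$ and $S\subseteq V$ put $$\breve q_S(p)=\sum_{I\subseteq S,\ I\text{ independent in }G}(-1)^{|I|}\prod_{v\in I}p_v ,$$ and let the Shearer region $\mathcal S_G$ be the set of all $p\in(0,1)^V$ such that $\breve q_S(p)>0$ for every $S\subseteq V$. There is a deterministic algorithm which, given a graph $G$ on $n$ vertices with maximum degree $d$, a vector $p\in(0,1)^V$ and a number $0<\alpha<1$, halts with one of the two answers "$p\in\mathcal S_G$" or "$(1+\alpha)p\notin\mathcal S_G$", the answer given being correct, in running time $$(n/\alpha)^{O\left(\sqrt{n/\alpha}\,\log d\right)} ,$$ where the constant in $O(\cdot)$ is absolute, and where in this bound $n$ and $d$ are read as $\max(n,2)$ and $\max(d,2)$. Running time is the number of steps of a real-RAM program (one program for all inputs) that receives $n$, the adjacency matrix of $G$, $p$ and $\alpha$ in its memory; the unit-cost steps are reading and writing memory cells (with indirect addressing), addition and subtraction of natural numbers, exact real arithmetic $+,-,\times,/$, and comparisons, and the constants of the program are natural and rational numbers. -/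

import Mathlib

/-! ### The Shearer region -/

namespace Shearer

/-- The alternating-sign independence polynomial
`q̆_S(p) = ∑_{I ⊆ S, I independent in G} (-1)^|I| ∏_{v ∈ I} p_v`. -/
noncomputable def altIndepPoly {V : Type*} (G : SimpleGraph V) (S : Finset V) (p : V → ℝ) : ℝ :=
  ∑ I ∈ @Finset.filter (Finset V) (fun I => G.IsIndepSet (I : Set V)) (Classical.decPred _) S.powerset,
    (-1 : ℝ) ^ I.card * ∏ v ∈ I, p v

/-- The Shearer region `S_G`: the vectors `p ∈ (0,1)^V` with `q̆_S(p) > 0` for all `S ⊆ V`. -/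
def region {V : Type*} (G : SimpleGraph V) : Set (V → ℝ) :=
  {p | (∀ v, 0 < p v ∧ p v < 1) ∧ ∀ S : Finset V, 0 < altIndepPoly G S p}

end Shearer

/-! ### Deterministic real-RAM programs with a step count

The memory consists of arrays of natural numbers and arrays of real numbers, of which every program
uses only finitely many, accessed by indirect addressing.  Every elementary operation costs one
step: reading or writing a cell, adding or subtracting naturals, exact real field operations, and
comparisons.  There is neither a multiplication of naturals nor a conversion (floor) from reals to
naturals, and the constants of a program are natural and rational numbers. -/

namespace RealRAM

/-- A memory: `m.nat a i` is cell `i` of the `a`-th array of naturals, `m.real a i` is cell `i` of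
the `a`-th array of reals. -/
@[ext] structure Memory where
  nat : ℕ → ℕ → ℕ
  real : ℕ → ℕ → ℝ

namespace Memory

/-- Overwrite one natural cell. -/
def setNat (m : Memory) (a i k : ℕ) : Memory :=
  { m with nat := Function.update m.nat a (Function.update (m.nat a) i k) }

/-- Overwrite one real cell. -/
noncomputable def setReal (m : Memory) (a i : ℕ) (x : ℝ) : Memory :=
  { m with real := Function.update m.real a (Function.update (m.real a) i x) }

end Memory

/-- Expressions with natural values; `read a e` is the cell with index `e` of natural array `a`,
and `sub` is truncated subtraction. -/
inductive NatExpr : Type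
  | const (k : ℕ) : NatExpr
  | read (a : ℕ) (e : NatExpr) : NatExpr
  | add (e f : NatExpr) : NatExpr
  | sub (e f : NatExpr) : NatExpr

namespace NatExpr

/-- The value of an expression. -/
def eval (m : Memory) : NatExpr → ℕ
  | const k => k
  | read a e => m.nat a (e.eval m)
  | add e f => e.eval m + f.eval m
  | sub e f => e.eval m - f.eval m

/-- The number of steps needed to evaluate an expression. -/
def cost : NatExpr → ℕ
  | const _ => 1
  | read _ e => e.cost + 1
  | add e f => e.cost + f.cost + 1
  | sub e f => e.cost + f.cost + 1

end NatExpr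

/-- Expressions with real values; `read a e` is the cell with index `e` of real array `a`. -/
inductive RealExpr : Type
  | const (c : ℚ) : RealExpr
  | read (a : ℕ) (e : NatExpr) : RealExpr
  | add (e f : RealExpr) : RealExpr
  | sub (e f : RealExpr) : RealExpr
  | mul (e f : RealExpr) : RealExpr
  | div (e f : RealExpr) : RealExpr

namespace RealExpr

/-- The value of an expression.  Division by zero returns zero (a program that wants to avoid such
divisions can test the divisor first). -/
noncomputable def eval (m : Memory) : RealExpr → ℝ
  | const c => (c : ℝ)
  | read a e => m.real a (e.eval m)
  | add e f => e.eval m + f.eval m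
  | sub e f => e.eval m - f.eval m
  | mul e f => e.eval m * f.eval m
  | div e f => e.eval m / f.eval m

/-- The number of steps needed to evaluate an expression. -/
def cost : RealExpr → ℕ
  | const _ => 1
  | read _ e => e.cost + 1
  | add e f => e.cost + f.cost + 1
  | sub e f => e.cost + f.cost + 1
  | mul e f => e.cost + f.cost + 1
  | div e f => e.cost + f.cost + 1

end RealExpr

/-- Conditions for branching. -/
inductive Test : Type
  | natLe (e f : NatExpr) : Test
  | realLe (e f : RealExpr) : Test
  | not (b : Test) : Test
  | and (b c : Test) : Test

namespace Test

/-- The truth value of a test. -/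
def Holds (m : Memory) : Test → Prop
  | natLe e f => e.eval m ≤ f.eval m
  | realLe e f => e.eval m ≤ f.eval m
  | not b => ¬ b.Holds m
  | and b c => b.Holds m ∧ c.Holds m

/-- The number of steps needed to evaluate a test. -/
def cost : Test → ℕ
  | natLe e f => e.cost + f.cost + 1
  | realLe e f => e.cost + f.cost + 1
  | not b => b.cost + 1
  | and b c => b.cost + c.cost + 1

end Test

/-- Programs.  `setNat a e f` and `setReal a e f` write the value of `f` into the cell with index
`e` of the array `a`. -/
inductive Program : Type
  | skip : Program
  | setNat (a : ℕ) (e f : NatExpr) : Program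
  | setReal (a : ℕ) (e : NatExpr) (f : RealExpr) : Program
  | seq (P Q : Program) : Program
  | ite (b : Test) (P Q : Program) : Program
  | while (b : Test) (P : Program) : Program

/-- `Exec P m t m'`: the program `P`, started with memory `m`, halts after exactly `t` steps with
memory `m'`. -/
inductive Exec : Program → Memory → ℕ → Memory → Prop
  | skip (m : Memory) : Exec Program.skip m 1 m
  | setNat (a : ℕ) (e f : NatExpr) (m : Memory) :
      Exec (Program.setNat a e f) m (e.cost + f.cost + 1) (m.setNat a (e.eval m) (f.eval m))
  | setReal (a : ℕ) (e : NatExpr) (f : RealExpr) (m : Memory) :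
      Exec (Program.setReal a e f) m (e.cost + f.cost + 1) (m.setReal a (e.eval m) (f.eval m))
  | seq {P Q : Program} {m m' m'' : Memory} {t t' : ℕ} :
      Exec P m t m' → Exec Q m' t' m'' → Exec (Program.seq P Q) m (t + t') m''
  | iteTrue {b : Test} {P Q : Program} {m m' : Memory} {t : ℕ} :
      b.Holds m → Exec P m t m' → Exec (Program.ite b P Q) m (b.cost + 1 + t) m'
  | iteFalse {b : Test} {P Q : Program} {m m' : Memory} {t : ℕ} :
      ¬ b.Holds m → Exec Q m t m' → Exec (Program.ite b P Q) m (b.cost + 1 + t) m'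
  | whileFalse {b : Test} {P : Program} {m : Memory} :
      ¬ b.Holds m → Exec (Program.while b P) m (b.cost + 1) m
  | whileTrue {b : Test} {P : Program} {m m' m'' : Memory} {t t' : ℕ} :
      b.Holds m → Exec P m t m' → Exec (Program.while b P) m' t' m'' →
        Exec (Program.while b P) m (b.cost + 1 + t + t') m''

/-- Programs are deterministic: the initial memory determines the number of steps and the final
memory of a halting run. -/
theorem Exec.deterministic {P : Program} {m m₁ m₂ : Memory} {t₁ t₂ : ℕ}
    (h₁ : Exec P m t₁ m₁) (h₂ : Exec P m t₂ m₂) : t₁ = t₂ ∧ m₁ = m₂ := by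
  induction h₁ generalizing t₂ m₂ with
  | skip m => cases h₂; exact ⟨rfl, rfl⟩
  | setNat a e f m => cases h₂; exact ⟨rfl, rfl⟩
  | setReal a e f m => cases h₂; exact ⟨rfl, rfl⟩
  | seq _ _ ih ih' =>
    cases h₂ with
    | seq k k' =>
      obtain ⟨rfl, rfl⟩ := ih k
      obtain ⟨rfl, rfl⟩ := ih' k'
      exact ⟨rfl, rfl⟩
  | iteTrue hb _ ih =>
    cases h₂ with
    | iteTrue _ k => obtain ⟨rfl, rfl⟩ := ih k; exact ⟨rfl, rfl⟩
    | iteFalse hn _ => exact absurd hb hn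
  | iteFalse hn _ ih =>
    cases h₂ with
    | iteTrue hb _ => exact absurd hb hn
    | iteFalse _ k => obtain ⟨rfl, rfl⟩ := ih k; exact ⟨rfl, rfl⟩
  | whileFalse hn =>
    cases h₂ with
    | whileFalse _ => exact ⟨rfl, rfl⟩
    | whileTrue hb _ _ => exact absurd hb hn
  | whileTrue hb _ _ ih ih' =>
    cases h₂ with
    | whileFalse hn => exact absurd hb hn
    | whileTrue _ k k' =>
      obtain ⟨rfl, rfl⟩ := ih k
      obtain ⟨rfl, rfl⟩ := ih' k'
      exact ⟨rfl, rfl⟩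

open Classical in
/-- The initial memory for the input `(G, p, α)`, where `G` has the vertices `0, …, n - 1`:
* natural array `0` holds `n` in its cell `0`;
* natural array `1` holds the adjacency matrix of `G` in row-major order;
* real array `0` holds `p_0, …, p_{n-1}`;
* real array `1` holds `α` in its cell `0`;
* all other cells are `0`. -/
noncomputable def inputMemory {n : ℕ} (G : SimpleGraph (Fin n)) (p : Fin n → ℝ) (α : ℝ) :
    Memory where
  nat a k :=
    if a = 0 ∧ k = 0 then n
    else if a = 1 ∧ ∃ i j : Fin n, k = (i : ℕ) * n + (j : ℕ) ∧ G.Adj i j then 1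
    else 0
  real a k :=
    if a = 0 then (if h : k < n then p ⟨k, h⟩ else 0)
    else if a = 1 ∧ k = 0 then α
    else 0

/-- The answer of a run: cell `0` of natural array `2` of the final memory. -/
def Memory.output (m : Memory) : ℕ := m.nat 2 0

end RealRAM

/-! ### Ratios of the alternating independence polynomial -/

namespace Shearer

/-! Write q_S for `altIndepPoly G S p`. Splitting independent sets by whether they contain a gives
q_{S∪a} = q_S - p_a q_{S∖N(a)}. Deleting the neighbours of a one at a time turns this into a
recursion for the ratios r(S,a) = q_{S∪a}/q_S, namely r(S,a) = 1 - p_a / ∏ r(S_b,b) over the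
neighbours b of a in S (`ratio_eq`). Ratios decrease when the weights or the set grow
(`ratio_anti`). Hence positivity on all subsets follows from positivity of n ratios, one for each
vertex relative to the later vertices (`PosOn.insert`).

The recursion truncated at a fixed depth gives upper bounds for the ratios, so it cannot fail inside
the region: failure for (1+α)p certifies (1+α)p ∉ S_G. For the converse, suppose that the weights
(1+β)w are still admissible. Measured against the logarithm of the quotient of the ratios for w and
(1+β)w, the logarithmic truncation error shrinks by a factor 1+√β per level (`log_contraction`,
`log_clip_div_ratio_le`); the square root comes from the quadratic term of exp and the inequality
between arithmetic and geometric mean. So depth of order β^(-1/2) log(n/β) makes the truncated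
product correct up to a factor 1+β, and a vertex that passes the truncated test can be added after
dividing the weights by (1+β)² (`posOn_insert_of_clip_pos`). With β = α/(4n) the n additions cost at
most a factor 1+α in total, so success for (1+α)p proves p ∈ S_G (`mem_region_of_clip_pos`).

The recursion tree has branching d and depth O(√(n/α) log(n/α)), and d to that power is
(n/α)^{O(√(n/α) log d)}. A real-RAM program walks the tree depth-first with an explicit stack, at
O(n) cost per step; a virtual root above all vertices merges the n tests into one evaluation
(`truncProd_root`). -/

open Classical in
theorem altIndepPoly_insert {V : Type*} [DecidableEq V] (G : SimpleGraph V) {a : V} {S : Finset V} (ha : a ∉ S)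
    (p : V → ℝ) :
    altIndepPoly G (insert a S) p =
      altIndepPoly G S p - p a * altIndepPoly G (S.filter fun c => ¬ G.Adj a c) p := by
  have key : ∀ t ∈ S.powerset, (G.IsIndepSet ((insert a t : Finset V) : Set V) ↔
      G.IsIndepSet (t : Set V) ∧ ∀ c ∈ t, ¬ G.Adj a c) := by
    intro t ht
    have hat : a ∉ t := fun h => ha (Finset.mem_powerset.1 ht h)
    rw [Finset.coe_insert, SimpleGraph.IsIndepSet,
      Set.pairwise_insert]
    refine and_congr_right fun _ => ⟨fun h c hc => (h c hc fun e => hat (e ▸ hc)).1,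
      fun h c hc _ => ⟨h c hc, fun h' => h c hc h'.symm⟩⟩
  unfold altIndepPoly
  have hfil : ∀ T : Finset V,
      @Finset.filter (Finset V) (fun I => G.IsIndepSet (I : Set V)) (Classical.decPred _) T.powerset
        = T.powerset.filter fun I : Finset V => G.IsIndepSet (I : Set V) := fun T => by congr
  -- Subsets without a give the first term. A subset containing a is independent iff its remainder
  -- is independent and avoids the neighbours of a; the extra element supplies the factor -p a.
  rw [hfil, hfil, hfil, Finset.sum_filter, Finset.sum_powerset_insert ha, ← Finset.sum_filter,
    ← Finset.sum_filter, sub_eq_add_neg]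
  congr 1
  rw [Finset.mul_sum, ← Finset.sum_neg_distrib]
  refine Finset.sum_congr ?_ ?_
  · ext t
    simp only [Finset.mem_filter, Finset.mem_powerset]
    constructor
    · rintro ⟨h1, h2⟩
      have := (key t (Finset.mem_powerset.2 h1)).1 h2
      exact ⟨fun c hc => Finset.mem_filter.2 ⟨h1 hc, this.2 c hc⟩, this.1⟩
    · rintro ⟨h1, h2⟩
      have h1' : t ⊆ S := h1.trans (Finset.filter_subset _ _)
      exact ⟨h1', (key t (Finset.mem_powerset.2 h1')).2
        ⟨h2, fun c hc => (Finset.mem_filter.1 (h1 hc)).2⟩⟩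
  · intro t ht
    have hat : a ∉ t := fun h =>
      ha ((Finset.mem_filter.1 (Finset.mem_powerset.1 (Finset.mem_filter.1 ht).1 h)).1)
    rw [Finset.card_insert_of_notMem hat, Finset.prod_insert hat]
    ring

theorem altIndepPoly_empty {V : Type*} (G : SimpleGraph V) (p : V → ℝ) :
    altIndepPoly G ∅ p = 1 := by
  unfold altIndepPoly
  rw [Finset.powerset_empty, Finset.filter_singleton, if_pos (by simp)]
  simp

/-- `q̆` is positive on all subsets of `U`. -/
def PosOn {V : Type*} (G : SimpleGraph V) (p : V → ℝ) (U : Finset V) : Prop :=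
  ∀ T ⊆ U, 0 < altIndepPoly G T p

theorem PosOn.mono {V : Type*} {G : SimpleGraph V} {p : V → ℝ} {U W : Finset V}
    (h : PosOn G p U) (hW : W ⊆ U) : PosOn G p W := fun T hT => h T (hT.trans hW)

theorem PosOn.pos {V : Type*} {G : SimpleGraph V} {p : V → ℝ} {U : Finset V}
    (h : PosOn G p U) : 0 < altIndepPoly G U p := h U subset_rfl

section

variable {V : Type*} [LinearOrder V]

/-- The ratio `q̆_{S ∪ a} / q̆_S`. -/
noncomputable def ratio (G : SimpleGraph V) (p : V → ℝ) (S : Finset V) (a : V) : ℝ :=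
  altIndepPoly G (insert a S) p / altIndepPoly G S p

open Classical in
/-- What is left of `S` for the neighbour `b` of `a`: the neighbours of `a` up to `b` are removed. -/
noncomputable def rest (adj : V → V → Prop) (a : V) (S : Finset V) (b : V) : Finset V :=
  S.filter fun c => ¬ (adj a c ∧ c ≤ b)

open Classical in
/-- The neighbours of `a` in `S`. -/
noncomputable def nbr (adj : V → V → Prop) (a : V) (S : Finset V) : Finset V :=
  S.filter (adj a)

theorem mem_nbr {W : Type*} {adj : W → W → Prop} {a b : W} {S : Finset W} :
    b ∈ nbr adj a S ↔ b ∈ S ∧ adj a b := by simp [nbr]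

theorem rest_subset (adj : V → V → Prop) (a : V) (S : Finset V) (b : V) :
    rest adj a S b ⊆ S := by classical exact Finset.filter_subset _ _

theorem notMem_rest {adj : V → V → Prop} {a : V} {S : Finset V} {b : V} (hb : b ∈ nbr adj a S) :
    b ∉ rest adj a S b := by
  simp [rest, (mem_nbr.1 hb).2]

theorem insert_rest_subset {adj : V → V → Prop} {a : V} {S : Finset V} {b : V}
    (hb : b ∈ nbr adj a S) : insert b (rest adj a S b) ⊆ S :=
  Finset.insert_subset (mem_nbr.1 hb).1 (rest_subset _ _ _ _)

theorem card_rest_lt {adj : V → V → Prop} {a : V} {S : Finset V} {b : V}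
    (hb : b ∈ nbr adj a S) : (rest adj a S b).card < S.card :=
  Finset.card_lt_card ⟨rest_subset _ _ _ _, fun h => notMem_rest hb (h (mem_nbr.1 hb).1)⟩

open Classical in
theorem rest_mono {adj : V → V → Prop} {a : V} {S T : Finset V} (h : T ⊆ S) (b : V) :
    rest adj a T b ⊆ rest adj a S b := Finset.filter_subset_filter _ h

open Classical in
/-- Removing the elements of `B` one after the other in increasing order. -/
theorem div_eq_prod_ratio (G : SimpleGraph V) (p : V → ℝ) (S B : Finset V) (hB : B ⊆ S)
    (hpos : PosOn G p S) :
    altIndepPoly G S p / altIndepPoly G (S \ B) p =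
      ∏ b ∈ B, ratio G p (S.filter fun c => ¬ (c ∈ B ∧ c ≤ b)) b := by
  induction B using Finset.induction_on_max with
  | empty => simp [hpos.pos.ne']
  | insert b B hb ih =>
    have hbB : b ∉ B := fun h => lt_irrefl _ (hb b h)
    have hbS : b ∈ S := hB (Finset.mem_insert_self _ _)
    rw [Finset.prod_insert hbB]
    -- Since b exceeds all of B, its own factor sees the whole of `insert b B` removed, while the
    -- factors of smaller elements are unaffected by b.
    have e1 : (S.filter fun c => ¬ (c ∈ insert b B ∧ c ≤ b)) = S \ insert b B := by
      ext c
      simp only [Finset.mem_filter, Finset.mem_insert, Finset.mem_sdiff]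
      refine and_congr_right fun _ => not_congr ⟨fun h => h.1, fun h => ⟨h, ?_⟩⟩
      rcases h with rfl | h
      · exact le_rfl
      · exact (hb c h).le
    have e2 : ∀ x ∈ B, (S.filter fun c => ¬ (c ∈ insert b B ∧ c ≤ x)) =
        S.filter fun c => ¬ (c ∈ B ∧ c ≤ x) := by
      intro x hx
      ext c
      simp only [Finset.mem_filter, Finset.mem_insert]
      refine and_congr_right fun _ => not_congr ⟨fun h => ⟨h.1.resolve_left ?_, h.2⟩,
        fun h => ⟨Or.inr h.1, h.2⟩⟩
      rintro rfl
      exact absurd (hb x hx) (not_lt.2 h.2)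
    rw [e1, Finset.prod_congr rfl fun x hx => by rw [e2 x hx],
      ← ih ((Finset.subset_insert _ _).trans hB), ratio]
    have e3 : insert b (S \ insert b B) = S \ B := by
      ext c
      simp only [Finset.mem_insert, Finset.mem_sdiff]
      by_cases hc : c = b
      · subst hc; simp [hbS, hbB]
      · simp [hc]
    rw [e3]
    have := (hpos _ (Finset.sdiff_subset (s := S) (t := B))).ne'
    have := (hpos _ (Finset.sdiff_subset (s := S) (t := insert b B))).ne'
    field_simp

-- Divide the deletion identity `altIndepPoly_insert` by the polynomial of S and telescope the
-- quotient that remains over the neighbours of a.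
open Classical in
theorem ratio_eq (G : SimpleGraph V) (p : V → ℝ) {S : Finset V} {a : V} (ha : a ∉ S)
    (hpos : PosOn G p S) :
    ratio G p S a = 1 - p a / ∏ b ∈ nbr G.Adj a S, ratio G p (rest G.Adj a S b) b := by
  have h1 : (S.filter fun c => ¬ G.Adj a c) = S \ nbr G.Adj a S := by
    ext c
    simp only [Finset.mem_filter, Finset.mem_sdiff, mem_nbr]
    tauto
  have h2 := div_eq_prod_ratio G p S (nbr G.Adj a S) (Finset.filter_subset _ _) hpos
  have h3 : ∀ b ∈ nbr G.Adj a S, (S.filter fun c => ¬ (c ∈ nbr G.Adj a S ∧ c ≤ b)) =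
      rest G.Adj a S b := by
    intro b _
    ext c
    simp only [rest, Finset.mem_filter, mem_nbr]
    tauto
  rw [Finset.prod_congr rfl fun b hb => by rw [h3 b hb]] at h2
  rw [← h2, ratio, altIndepPoly_insert G ha, h1]
  have := hpos.pos.ne'
  have := (hpos _ (Finset.sdiff_subset (s := S) (t := nbr G.Adj a S))).ne'
  field_simp

theorem ratio_pos {G : SimpleGraph V} {p : V → ℝ} {S : Finset V} {a : V}
    (h : PosOn G p (insert a S)) : 0 < ratio G p S a :=
  div_pos h.pos (h _ (Finset.subset_insert _ _))

theorem prod_ratio_pos {G : SimpleGraph V} {p : V → ℝ} {S : Finset V} (a : V)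
    (h : PosOn G p S) : 0 < ∏ b ∈ nbr G.Adj a S, ratio G p (rest G.Adj a S b) b :=
  Finset.prod_pos fun _ hb => ratio_pos (h.mono (insert_rest_subset hb))

theorem ratio_le_one {G : SimpleGraph V} {p : V → ℝ} {S : Finset V} {a : V} (ha : a ∉ S)
    (hp : ∀ v, 0 ≤ p v) (h : PosOn G p S) : ratio G p S a ≤ 1 := by
  rw [ratio_eq G p ha h]
  have := div_nonneg (hp a) (prod_ratio_pos a h).le
  linarith

theorem nbr_mono {W : Type*} {adj : W → W → Prop} {a : W} {S T : Finset W} (h : T ⊆ S) :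
    nbr adj a T ⊆ nbr adj a S := by classical exact Finset.filter_subset_filter _ h

/-- Ratios are antitone in the weights and in the set. -/
theorem ratio_anti {G : SimpleGraph V} {w w' : V → ℝ} (hw : ∀ v, 0 ≤ w v) (hww : ∀ v, w v ≤ w' v)
    (N : ℕ) : ∀ {S T : Finset V} {a : V}, S.card ≤ N → T ⊆ S → a ∉ S → PosOn G w S →
      PosOn G w' S → ratio G w' S a ≤ ratio G w T a := by
  induction N with
  | zero =>
    intro S T a hN hT ha h h'
    obtain rfl := Finset.card_eq_zero.1 (Nat.le_zero.1 hN)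
    obtain rfl := Finset.subset_empty.1 hT
    rw [ratio_eq G w ha h, ratio_eq G w' ha h']
    simp only [nbr, Finset.filter_empty, Finset.prod_empty, div_one]
    linarith [hww a]
  | succ N ih =>
    intro S T a hN hT ha h h'
    have haT : a ∉ T := fun e => ha (hT e)
    rw [ratio_eq G w haT (h.mono hT), ratio_eq G w' ha h']
    -- Passing from T to S adds factors that are at most 1 and, by induction, lowers those already
    -- present, because the remaining sets grow as well.
    have hle : ∏ b ∈ nbr G.Adj a S, ratio G w' (rest G.Adj a S b) b ≤
        ∏ b ∈ nbr G.Adj a T, ratio G w (rest G.Adj a T b) b := by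
      refine (Finset.prod_le_prod_of_subset_of_le_one (nbr_mono hT)
        (fun b hb => (ratio_pos (h'.mono (insert_rest_subset hb))).le)
        (fun b hb _ => ratio_le_one (notMem_rest hb) (fun v => (hw v).trans (hww v))
          (h'.mono (rest_subset _ _ _ _)))).trans ?_
      refine Finset.prod_le_prod
        (fun b hb => (ratio_pos (h'.mono (insert_rest_subset (nbr_mono hT hb)))).le) fun b hb => ?_
      have hb' := nbr_mono hT hb
      exact ih (by have := card_rest_lt hb'; omega) (rest_mono hT b) (notMem_rest hb')
        (h.mono (rest_subset _ _ _ _)) (h'.mono (rest_subset _ _ _ _))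
    have h0 := prod_ratio_pos a h'
    have := div_le_div₀ ((hw a).trans (hww a)) (hww a) h0 hle
    linarith

/-- One ratio controls all subsets: the ratio of a over a subset of S is at least the ratio over S.
-/
theorem PosOn.insert {G : SimpleGraph V} {w : V → ℝ} (hw : ∀ v, 0 ≤ w v) {S : Finset V} {a : V}
    (ha : a ∉ S) (h : PosOn G w S) (hr : 0 < ratio G w S a) : PosOn G w (insert a S) := by
  intro T hT
  by_cases haT : a ∈ T
  · have hsub : T.erase a ⊆ S := by
      rw [← Finset.subset_insert_iff]; exact hT
    have h1 := hr.trans_le (ratio_anti hw (fun _ => le_rfl) _ le_rfl hsub ha h h)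
    rw [ratio, Finset.insert_erase haT] at h1
    exact (div_pos_iff_of_pos_right (h _ hsub)).1 h1
  · exact h T ((Finset.subset_insert_iff_of_notMem haT).1 hT)

/-- Add the vertices one at a time; each new ratio for the smaller weights dominates the positive
one for the larger weights. -/
theorem PosOn.anti {G : SimpleGraph V} {w w' : V → ℝ} (hw : ∀ v, 0 ≤ w v)
    (hww : ∀ v, w v ≤ w' v) {S : Finset V} (h : PosOn G w' S) : PosOn G w S := by
  induction S using Finset.induction_on with
  | empty =>
    intro T hT
    rw [Finset.subset_empty.1 hT, altIndepPoly_empty]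
    exact one_pos
  | insert a S ha ih =>
    have hS := ih (h.mono (Finset.subset_insert _ _))
    exact PosOn.insert hw ha hS ((ratio_pos h).trans_le
      (ratio_anti hw hww _ le_rfl subset_rfl ha hS (h.mono (Finset.subset_insert _ _))))

end

end Shearer

/-! ### Truncated recursion and decay of correlations -/

namespace Shearer

/-- `1 - x / P`, replaced by `0` unless it is positive and `x < P`. -/
noncomputable def clip (x P : ℝ) : ℝ := if x < P then 1 - x / P else 0

theorem clip_nonneg {x P : ℝ} (hx : 0 ≤ x) : 0 ≤ clip x P := by
  unfold clip
  split_ifs with h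
  · have := (div_lt_one (hx.trans_lt h)).2 h
    linarith
  · exact le_rfl

theorem clip_le_one {x P : ℝ} (hx : 0 ≤ x) : clip x P ≤ 1 := by
  unfold clip
  split_ifs with h
  · have := div_nonneg hx (hx.trans h.le)
    linarith
  · exact zero_le_one

theorem lt_of_clip_pos {x P : ℝ} (h : 0 < clip x P) : x < P := by
  by_contra h'
  simp [clip, h'] at h

/-- The value 0 at failure is the least possible one, so clipping preserves the monotonicity of 1 -
x / P. -/
theorem clip_mono {x y P Q : ℝ} (hx : 0 ≤ x) (hxy : x ≤ y) (hPQ : P ≤ Q) :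
    clip y P ≤ clip x Q := by
  by_cases h : y < P
  · have h2 : x < Q := by linarith
    rw [clip, clip, if_pos h, if_pos h2]
    have := div_le_div₀ (hx.trans hxy) hxy (by linarith) hPQ
    linarith
  · rw [clip, if_neg h]
    exact clip_nonneg hx

section

variable {V : Type*} [LinearOrder V]

/-- The product over the neighbours of `a` in `S` of the ratios computed by the recursion which is
truncated at depth `k`. -/
noncomputable def truncProd (adj : V → V → Prop) (p : V → ℝ) : ℕ → V → Finset V → ℝ
  | 0, _, _ => 1
  | k + 1, a, S => ∏ b ∈ nbr adj a S, clip (p b) (truncProd adj p k b (rest adj a S b))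

theorem truncProd_anti {adj : V → V → Prop} {p p' : V → ℝ} (hp : ∀ v, 0 ≤ p v)
    (hpp : ∀ v, p v ≤ p' v) (k : ℕ) : ∀ (a : V) (S : Finset V),
      truncProd adj p' k a S ≤ truncProd adj p k a S := by
  induction k with
  | zero => exact fun _ _ => le_rfl
  | succ k ih =>
    exact fun a S => Finset.prod_le_prod (fun b _ => clip_nonneg ((hp b).trans (hpp b)))
      fun b _ => clip_mono (hp b) (hpp b) (ih _ _)

theorem prod_ratio_le_one {G : SimpleGraph V} {w : V → ℝ} (hw : ∀ v, 0 ≤ w v) (a : V)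
    {S : Finset V} (h : PosOn G w S) :
    ∏ b ∈ nbr G.Adj a S, ratio G w (rest G.Adj a S b) b ≤ 1 :=
  Finset.prod_le_one (fun _ hb => (ratio_pos (h.mono (insert_rest_subset hb))).le)
    fun _ hb => ratio_le_one (notMem_rest hb) hw (h.mono (rest_subset _ _ _ _))

/-- Positivity of the true ratio means that nothing is clipped at the true product; monotonicity
then passes to the larger Q. -/
theorem ratio_le_clip {G : SimpleGraph V} {w : V → ℝ} (hw : ∀ v, 0 ≤ w v) {S : Finset V} {a : V}
    (ha : a ∉ S) (h : PosOn G w (insert a S)) {Q : ℝ}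
    (hQ : ∏ b ∈ nbr G.Adj a S, ratio G w (rest G.Adj a S b) b ≤ Q) :
    ratio G w S a ≤ clip (w a) Q := by
  have hS := h.mono (Finset.subset_insert a S)
  have hr := ratio_pos h
  rw [ratio_eq G w ha hS] at hr ⊢
  have hP := prod_ratio_pos a hS
  have hlt : w a < ∏ b ∈ nbr G.Adj a S, ratio G w (rest G.Adj a S b) b := by
    rw [← div_lt_one hP]; linarith
  have := clip_mono (hw a) le_rfl hQ
  rwa [clip, if_pos hlt] at this

/-- The truncated recursion gives upper bounds for the true ratios. -/
theorem prod_ratio_le_truncProd {G : SimpleGraph V} {w : V → ℝ} (hw : ∀ v, 0 ≤ w v) (k : ℕ) :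
    ∀ {S : Finset V} (a : V), PosOn G w S →
      ∏ b ∈ nbr G.Adj a S, ratio G w (rest G.Adj a S b) b ≤ truncProd G.Adj w k a S := by
  induction k with
  | zero => exact fun a h => prod_ratio_le_one hw a h
  | succ k ih =>
    intro S a h
    refine Finset.prod_le_prod
      (fun b hb => (ratio_pos (h.mono (insert_rest_subset hb))).le) fun b hb => ?_
    exact ratio_le_clip hw (notMem_rest hb) (h.mono (insert_rest_subset hb))
      (ih b (h.mono (rest_subset _ _ _ _)))

/-- One step of the recursion contracts the logarithmic error, measured by the logarithmic effect
of multiplying the weights by `1 + β`. -/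
theorem log_contraction {c β η ρ P P' Q : ℝ} (hc : 0 < c) (hβ0 : 0 < β) (hβ1 : β ≤ 1)
    (hη : 0 ≤ η) (hηβ : η ^ 2 ≤ β) (hρ : 0 ≤ ρ) (hP' : 0 < P') (hPP : P' ≤ P) (hPQ : P ≤ Q)
    (hX' : 0 < 1 - (1 + β) * c / P')
    (hE : Real.log (Q / P) ≤ ρ * Real.log (P / P')) :
    Real.log ((1 - c / Q) / (1 - c / P)) ≤
      ρ / (1 + η) * Real.log ((1 - c / P) / (1 - (1 + β) * c / P')) := by
  have hP : 0 < P := hP'.trans_le hPP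
  have hQ : 0 < Q := hP.trans_le hPQ
  -- exp M is the factor by which c / P grows when the weights are scaled, that is, when c / P
  -- becomes (1 + β) * c / P'.
  set M := Real.log (1 + β) + Real.log (P / P') with hM
  have hγ : β / 2 ≤ Real.log (1 + β) := by
    have := Real.one_sub_inv_le_log_of_pos (show 0 < 1 + β by linarith)
    have h2 : β / 2 ≤ 1 - (1 + β)⁻¹ := by
      have h3 : (1 + β)⁻¹ * (1 + β) = 1 := inv_mul_cancel₀ (by linarith)
      have h4 : 0 < (1 + β)⁻¹ := by positivity
      nlinarith
    linarith
  have hN0 : 0 ≤ Real.log (P / P') := Real.log_nonneg ((one_le_div hP').2 hPP)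
  have hM0 : 0 ≤ M := by linarith
  have hexp : Real.exp M = (1 + β) * (P / P') := by
    rw [hM, Real.exp_add, Real.exp_log (by linarith), Real.exp_log (by positivity)]
  have hφ : 0 < c / P := by positivity
  have hφ' : (1 + β) * c / P' = c / P * Real.exp M := by
    rw [hexp]; field_simp
  have hX : 0 < 1 - c / P := by
    have : c / P ≤ c / P * Real.exp M := le_mul_of_one_le_right hφ.le (Real.one_le_exp hM0)
    linarith
  have hY : 0 < 1 - c / Q := by
    have : c / Q ≤ c / P := by gcongr
    linarith
  set X := 1 - c / P with hXdef
  -- upper bound for the error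
  have h1 : Real.log ((1 - c / Q) / X) ≤ c / P / X * Real.log (Q / P) := by
    have a1 := Real.log_le_sub_one_of_pos (show 0 < (1 - c / Q) / X by positivity)
    have a2 := Real.one_sub_inv_le_log_of_pos (show 0 < Q / P by positivity)
    have a3 : (1 - c / Q) / X - 1 = c / P / X * (1 - (Q / P)⁻¹) := by
      rw [div_sub_one hX.ne', div_mul_eq_mul_div]
      congr 1
      rw [hXdef]
      field_simp
      ring
    rw [a3] at a1
    exact a1.trans (mul_le_mul_of_nonneg_left a2 (by positivity))
  -- lower bound for the effect of the slack
  have h2 : c / P / X * (M + M ^ 2 / 2) ≤ Real.log (X / (1 - (1 + β) * c / P')) := by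
    have a2 := Real.one_sub_inv_le_log_of_pos
      (show 0 < X / (1 - (1 + β) * c / P') by positivity)
    have a3 : 1 - (X / (1 - (1 + β) * c / P'))⁻¹ = c / P / X * (Real.exp M - 1) := by
      rw [inv_div, hφ', one_sub_div hX.ne', div_mul_eq_mul_div]
      rw [hXdef]
      ring
    rw [a3] at a2
    refine le_trans (mul_le_mul_of_nonneg_left ?_ (by positivity)) a2
    have := Real.quadratic_le_exp_of_nonneg hM0
    linarith
  -- With γ = log(1+β) ≥ β/2 ≥ η²/2, it suffices that ηM ≤ M²/2 + η²/2. This is where a gain η of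
  -- order √β, rather than β, comes from.
  have h3 : Real.log (P / P') ≤ (M + M ^ 2 / 2) / (1 + η) := by
    rw [le_div_iff₀ (by linarith)]
    have e : Real.log (P / P') = M - Real.log (1 + β) := by rw [hM]; ring
    rw [e]
    nlinarith [sq_nonneg (M - η)]
  calc Real.log ((1 - c / Q) / X) ≤ c / P / X * Real.log (Q / P) := h1
    _ ≤ c / P / X * (ρ * ((M + M ^ 2 / 2) / (1 + η))) := by
        refine mul_le_mul_of_nonneg_left (hE.trans (mul_le_mul_of_nonneg_left h3 hρ)) (by positivity)
    _ = ρ / (1 + η) * (c / P / X * (M + M ^ 2 / 2)) := by ring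
    _ ≤ _ := mul_le_mul_of_nonneg_left h2 (by positivity)

theorem one_sub_mul_le_rpow {β φ : ℝ} (hβ : 0 ≤ β) (hφ : φ ≤ 1) :
    1 - (1 + β) * φ ≤ (1 - φ) ^ (1 + β) := by
  have := one_add_mul_self_le_rpow_one_add (s := -φ) (by linarith) (p := 1 + β) (by linarith)
  calc 1 - (1 + β) * φ = 1 + (1 + β) * -φ := by ring
    _ ≤ _ := this
    _ = _ := by ring_nf

/-- A ratio decreases by a definite amount if the weights are multiplied by `1 + β`. -/
theorem ratio_scale_le {G : SimpleGraph V} {w : V → ℝ} {β : ℝ} (hβ : 0 ≤ β) (hw : ∀ v, 0 ≤ w v)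
    {S : Finset V} {a : V} (ha : a ∉ S) (h : PosOn G ((1 + β) • w) S) :
    ratio G ((1 + β) • w) S a ≤ 1 - (1 + β) * (1 - ratio G w S a) := by
  have hle : ∀ v, w v ≤ ((1 + β) • w) v := fun v => by
    simpa using le_mul_of_one_le_left (hw v) (by linarith : 1 ≤ 1 + β)
  have h0 := h.anti hw hle
  rw [ratio_eq G _ ha h, ratio_eq G _ ha h0]
  -- The weight in the numerator grows by 1 + β and the product below it does not increase, so the
  -- deficit 1 - ratio grows at least by that factor.
  have h1 : ∏ b ∈ nbr G.Adj a S, ratio G ((1 + β) • w) (rest G.Adj a S b) b ≤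
      ∏ b ∈ nbr G.Adj a S, ratio G w (rest G.Adj a S b) b :=
    Finset.prod_le_prod (fun b hb => (ratio_pos (h.mono (insert_rest_subset hb))).le)
      fun b hb => ratio_anti hw hle _ le_rfl subset_rfl (notMem_rest hb)
        (h0.mono (rest_subset _ _ _ _)) (h.mono (rest_subset _ _ _ _))
  have h2 := prod_ratio_pos a h
  have h3 : w a / ∏ b ∈ nbr G.Adj a S, ratio G w (rest G.Adj a S b) b ≤
      w a / ∏ b ∈ nbr G.Adj a S, ratio G ((1 + β) • w) (rest G.Adj a S b) b :=
    div_le_div_of_nonneg_left (hw a) h2 h1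
  have h4 := mul_le_mul_of_nonneg_left h3 (by linarith : 0 ≤ 1 + β)
  simp only [Pi.smul_apply, smul_eq_mul] at *
  rw [mul_div_assoc]
  linarith

/-- Decay of correlations. -/
theorem log_clip_div_ratio_le {G : SimpleGraph V} {w : V → ℝ} {β η : ℝ} (hβ0 : 0 < β)
    (hβ1 : β ≤ 1) (hη : 0 ≤ η) (hηβ : η ^ 2 ≤ β) (hw : ∀ v, 0 < w v) (k : ℕ) :
    ∀ {S : Finset V} {a : V}, a ∉ S → PosOn G ((1 + β) • w) (insert a S) →
      Real.log (clip (w a) (truncProd G.Adj w k a S) / ratio G w S a) ≤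
        1 / β / (1 + η) ^ k * Real.log (ratio G w S a / ratio G ((1 + β) • w) S a) := by
  have hw0 : ∀ v, 0 ≤ w v := fun v => (hw v).le
  have hle : ∀ v, w v ≤ ((1 + β) • w) v := fun v => by
    simpa using le_mul_of_one_le_left (hw0 v) (by linarith : 1 ≤ 1 + β)
  induction k with
  | zero =>
    intro S a ha h'
    have hS' := h'.mono (Finset.subset_insert a S)
    have h := h'.anti hw0 hle
    have hS := h.mono (Finset.subset_insert a S)
    have hX := ratio_pos h
    have hX' := ratio_pos h'
    have hX1 := ratio_le_one ha hw0 hS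
    have a1 : Real.log (clip (w a) (truncProd G.Adj w 0 a S) / ratio G w S a) ≤
        - Real.log (ratio G w S a) := by
      rw [← Real.log_inv]
      have hc := ratio_le_clip hw0 ha h (prod_ratio_le_truncProd hw0 0 a hS)
      refine Real.log_le_log (div_pos (hX.trans_le hc) hX) ?_
      rw [div_eq_mul_inv]
      exact mul_le_of_le_one_left (by positivity) (clip_le_one (hw0 a))
    -- Bernoulli turns X' ≤ 1 - (1+β)(1-X) into X' ≤ X^(1+β), so log(X/X') ≥ -β log X. This is the
    -- origin of the initial factor 1/β.
    have a2 : Real.log (ratio G ((1 + β) • w) S a) ≤ (1 + β) * Real.log (ratio G w S a) := by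
      rw [← Real.log_rpow hX]
      refine Real.log_le_log hX' ((ratio_scale_le hβ0.le hw0 ha hS').trans ?_)
      simpa using one_sub_mul_le_rpow (φ := 1 - ratio G w S a) hβ0.le (by linarith)
    rw [Real.log_div hX.ne' hX'.ne', pow_zero, div_one, one_div, inv_mul_eq_div,
      le_div_iff₀ hβ0]
    nlinarith
  | succ k ih =>
    intro S a ha h'
    have hS' := h'.mono (Finset.subset_insert a S)
    have h := h'.anti hw0 hle
    have hS := h.mono (Finset.subset_insert a S)
    have hX := ratio_pos h
    have hX' := ratio_pos h'
    have hsub : ∀ b ∈ nbr G.Adj a S, 0 < ratio G w (rest G.Adj a S b) b ∧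
        0 < ratio G ((1 + β) • w) (rest G.Adj a S b) b ∧
        0 < clip (w b) (truncProd G.Adj w k b (rest G.Adj a S b)) := fun b hb => by
      have hb1 := ratio_pos (hS.mono (insert_rest_subset hb))
      refine ⟨hb1, ratio_pos (hS'.mono (insert_rest_subset hb)), hb1.trans_le ?_⟩
      exact ratio_le_clip hw0 (notMem_rest hb) (hS.mono (insert_rest_subset hb))
        (prod_ratio_le_truncProd hw0 k b (hS.mono (rest_subset _ _ _ _)))
    have hP' := prod_ratio_pos a hS'
    have hPP : ∏ b ∈ nbr G.Adj a S, ratio G ((1 + β) • w) (rest G.Adj a S b) b ≤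
        ∏ b ∈ nbr G.Adj a S, ratio G w (rest G.Adj a S b) b :=
      Finset.prod_le_prod (fun b hb => (hsub b hb).2.1.le)
        fun b hb => ratio_anti hw0 hle _ le_rfl subset_rfl (notMem_rest hb)
          (hS.mono (rest_subset _ _ _ _)) (hS'.mono (rest_subset _ _ _ _))
    have hPQ := prod_ratio_le_truncProd hw0 (k + 1) a hS
    have hE : Real.log (truncProd G.Adj w (k + 1) a S /
          ∏ b ∈ nbr G.Adj a S, ratio G w (rest G.Adj a S b) b) ≤
        1 / β / (1 + η) ^ k * Real.log ((∏ b ∈ nbr G.Adj a S, ratio G w (rest G.Adj a S b) b) /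
          ∏ b ∈ nbr G.Adj a S, ratio G ((1 + β) • w) (rest G.Adj a S b) b) := by
      -- Logarithms turn the products into sums, and the bound for each child has the same factor,
      -- so branching costs nothing.
      rw [truncProd, ← Finset.prod_div_distrib, ← Finset.prod_div_distrib,
        Real.log_prod fun b hb => (div_pos (hsub b hb).2.2 (hsub b hb).1).ne',
        Real.log_prod fun b hb => (div_pos (hsub b hb).1 (hsub b hb).2.1).ne',
        Finset.mul_sum]
      exact Finset.sum_le_sum fun b hb => ih (notMem_rest hb) (hS'.mono (insert_rest_subset hb))
    have e := ratio_eq G w ha hS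
    have e' := ratio_eq G ((1 + β) • w) ha hS'
    rw [Pi.smul_apply, smul_eq_mul] at e'
    have hlt : w a < truncProd G.Adj w (k + 1) a S := by
      refine lt_of_lt_of_le ?_ hPQ
      rw [← div_lt_one (hP'.trans_le hPP)]
      linarith
    rw [clip, if_pos hlt]
    have := log_contraction (hw a) hβ0 hβ1 hη hηβ (by positivity : 0 ≤ 1 / β / (1 + η) ^ k) hP'
      hPP hPQ (by rwa [← e']) hE
    rw [← e, ← e'] at this
    rwa [pow_succ, ← div_div]

end

end Shearer

/-! ### Correctness of the test: adding the vertices one by one -/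

namespace Shearer

section

variable {V : Type*} [LinearOrder V]

/-- If the weights have some slack on `S` and the truncated recursion for `a` succeeds for slightly
larger weights, then `a` may be added to `S`. -/
theorem posOn_insert_of_clip_pos {G : SimpleGraph V} {w p' : V → ℝ} {β η N : ℝ} (hβ0 : 0 < β)
    (hβ1 : β ≤ 1) (hη : 0 ≤ η) (hηβ : η ^ 2 ≤ β) (hw : ∀ v, 0 < w v)
    (hp' : ∀ v, (1 + β) * w v ≤ p' v) {k : ℕ} {S : Finset V} {a : V} (ha : a ∉ S)
    (hcard : (S.card : ℝ) ≤ N) (hk : 2 * N ≤ β ^ 3 * (1 + η) ^ k)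
    (hS : PosOn G ((1 + β) • (1 + β) • w) S)
    (hclip : 0 < clip (p' a) (truncProd G.Adj p' (k + 1) a S)) : PosOn G w (insert a S) := by
  have hw0 : ∀ v, 0 ≤ w v := fun v => (hw v).le
  have hw1 : ∀ v, 0 ≤ ((1 + β) • w) v := fun v => by
    have := hw v
    simp only [Pi.smul_apply, smul_eq_mul]
    positivity
  have hle : ∀ v, w v ≤ ((1 + β) • w) v := fun v => by
    simpa using le_mul_of_one_le_left (hw0 v) (by linarith : 1 ≤ 1 + β)
  have hle' : ∀ v, ((1 + β) • w) v ≤ ((1 + β) • (1 + β) • w) v := fun v => by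
    simpa using le_mul_of_one_le_left (hw1 v) (by linarith : 1 ≤ 1 + β)
  have hS1 : PosOn G ((1 + β) • w) S := hS.anti hw1 hle'
  have hS0 : PosOn G w S := hS1.anti hw0 hle
  have hwp : ∀ v, w v ≤ p' v := fun v => (hle v).trans (hp' v)
  have hQ : p' a < truncProd G.Adj w (k + 1) a S :=
    (lt_of_clip_pos hclip).trans_le (truncProd_anti hw0 hwp _ _ _)
  have hP := prod_ratio_pos a hS0
  refine hS0.insert hw0 ha ?_
  rw [ratio_eq G w ha hS0, sub_pos, div_lt_one hP]
  set P := ∏ b ∈ nbr G.Adj a S, ratio G w (rest G.Adj a S b) b with hPdef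
  have hQ0 : 0 < truncProd G.Adj w (k + 1) a S := lt_of_le_of_lt ((hw0 a).trans (hwp a)) hQ
  have hterm : ∀ b ∈ nbr G.Adj a S,
      -- The second factor 1+β of slack keeps X' away from 0: positivity of X'' forces (1+β)X' > β,
      -- hence log(X/X') ≤ X/X' - 1 ≤ 1/β.
      Real.log (clip (w b) (truncProd G.Adj w k b (rest G.Adj a S b)) /
        ratio G w (rest G.Adj a S b) b) ≤ 1 / β / (1 + η) ^ k * (1 / β) := by
    intro b hb
    refine (log_clip_div_ratio_le hβ0 hβ1 hη hηβ hw k (notMem_rest hb)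
      (hS1.mono (insert_rest_subset hb))).trans (mul_le_mul_of_nonneg_left ?_ (by positivity))
    have hX := ratio_pos (hS0.mono (insert_rest_subset hb))
    have hX' := ratio_pos (hS1.mono (insert_rest_subset hb))
    have hX'' := ratio_pos (hS.mono (insert_rest_subset hb))
    have h1 := ratio_scale_le hβ0.le hw1 (notMem_rest hb) (hS.mono (rest_subset _ _ _ _))
    have h2 := ratio_le_one (notMem_rest hb) hw0 (hS0.mono (rest_subset _ _ _ _))
    set X := ratio G w (rest G.Adj a S b) b
    set X' := ratio G ((1 + β) • w) (rest G.Adj a S b) b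
    have h3 := Real.log_le_sub_one_of_pos (div_pos hX hX')
    have h4 : X / X' ≤ 1 / β + 1 := by
      rw [div_le_iff₀ hX']
      have h5 : β ≤ (1 + β) * X' := by nlinarith
      have h6 : (1 / β + 1) * X' = (1 + β) * X' / β := by field_simp
      rw [h6]
      exact h2.trans ((one_le_div hβ0).2 h5)
    linarith
  -- Over at most N children the errors add up to at most N / (β² (1+η)^k) ≤ β/2 ≤ log(1+β); `hk` is
  -- chosen for this.
  have hlog : Real.log (truncProd G.Adj w (k + 1) a S / P) ≤ Real.log (1 + β) := by
    have hsub : ∀ b ∈ nbr G.Adj a S, clip (w b) (truncProd G.Adj w k b (rest G.Adj a S b)) /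
        ratio G w (rest G.Adj a S b) b ≠ 0 := fun b hb => by
      have hb1 := ratio_pos (hS0.mono (insert_rest_subset hb))
      have := hb1.trans_le (ratio_le_clip hw0 (notMem_rest hb) (hS0.mono (insert_rest_subset hb))
        (prod_ratio_le_truncProd hw0 k b (hS0.mono (rest_subset _ _ _ _))))
      positivity
    rw [truncProd, hPdef, ← Finset.prod_div_distrib, Real.log_prod hsub]
    have h1 := Finset.sum_le_card_nsmul _ _ _ hterm
    have h2 : ((nbr G.Adj a S).card : ℝ) ≤ N := by
      refine le_trans ?_ hcard
      exact_mod_cast Finset.card_le_card (fun b hb => (mem_nbr.1 hb).1)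
    have h3 := Real.one_sub_inv_le_log_of_pos (show 0 < 1 + β by linarith)
    have h4 : β / 2 ≤ 1 - (1 + β)⁻¹ := by
      have h5 : (1 + β)⁻¹ * (1 + β) = 1 := inv_mul_cancel₀ (by linarith)
      have h6 : 0 < (1 + β)⁻¹ := by positivity
      nlinarith
    rw [nsmul_eq_mul] at h1
    have h7 : ((nbr G.Adj a S).card : ℝ) * (1 / β / (1 + η) ^ k * (1 / β)) ≤ β / 2 := by
      refine (mul_le_mul_of_nonneg_right h2 (by positivity)).trans ?_
      have h8 : N * (1 / β / (1 + η) ^ k * (1 / β)) = N / (β ^ 2 * (1 + η) ^ k) := by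
        field_simp
      rw [h8, div_le_iff₀ (by positivity)]
      nlinarith
    linarith
  -- The truncated product for w is at most (1+β)P, and success of the test puts it above p' a ≥
  -- (1+β) w a; the factor 1+β cancels.
  have h1 := (Real.log_le_log_iff (div_pos hQ0 hP) (by linarith)).1 hlog
  rw [div_le_iff₀ hP] at h1
  have h2 := hp' a
  have h3 : (1 + β) * w a < (1 + β) * P := by linarith
  exact lt_of_mul_lt_mul_left h3 (by linarith)

/-- The recursion succeeds on the Shearer region. -/
theorem clip_truncProd_pos {G : SimpleGraph V} {w : V → ℝ} (hw : ∀ v, 0 ≤ w v) (k : ℕ)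
    {S : Finset V} {a : V} (ha : a ∉ S) (h : PosOn G w (insert a S)) :
    0 < clip (w a) (truncProd G.Adj w k a S) :=
  (ratio_pos h).trans_le (ratio_le_clip hw ha h
    (prod_ratio_le_truncProd hw k a (h.mono (Finset.subset_insert a S))))

end

/-- Every s levels gain a factor (1+1/s)^s ≥ 2, so 4sL levels gain at least (2^L)^4 ≥ β^(-4) with β
= α/(4n). Three powers of 1/β are consumed by β³; the fourth pays for 2n and for the one level lost
between k+1 and k. -/
theorem two_mul_le_pow_of_depth {n s L k : ℕ} {α : ℝ} (hn : 0 < n) (hα : 0 < α) (hα1 : α < 1)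
    (hs : 1 ≤ s) (hL : 4 * (n : ℝ) ≤ 2 ^ L * α) (hk : 4 * s * L ≤ k + 1) :
    2 * (n : ℝ) ≤ (α / (4 * n)) ^ 3 * (1 + 1 / (s : ℝ)) ^ k := by
  have hn' : (1 : ℝ) ≤ n := by exact_mod_cast hn
  have hs' : (1 : ℝ) ≤ s := by exact_mod_cast hs
  set β := α / (4 * n) with hβ
  have hβ0 : 0 < β := by positivity
  have hL' : 1 / β ≤ 2 ^ L := by
    rw [hβ, one_div_div, div_le_iff₀ hα]; exact hL
  have h1 : (2 : ℝ) ≤ (1 + 1 / (s : ℝ)) ^ s := by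
    have := one_add_mul_le_pow (a := 1 / (s : ℝ)) (by have : 0 ≤ 1 / (s : ℝ) := by positivity
                                                      linarith) s
    have e : (s : ℝ) * (1 / s) = 1 := by field_simp
    linarith
  have h2 : (1 / β) ^ 4 ≤ (1 + 1 / (s : ℝ)) ^ (k + 1) := by
    calc (1 / β) ^ 4 ≤ (2 ^ L) ^ 4 := by gcongr
      _ = (2 ^ (4 * L)) := by rw [← pow_mul, mul_comm]
      _ ≤ ((1 + 1 / (s : ℝ)) ^ s) ^ (4 * L) := by gcongr
      _ = (1 + 1 / (s : ℝ)) ^ (4 * s * L) := by rw [← pow_mul]; congr 1; ring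
      _ ≤ _ := pow_le_pow_right₀ (by have : 0 ≤ 1 / (s : ℝ) := by positivity
                                     linarith) hk
  have h3 : 1 / (s : ℝ) ≤ 1 := (div_le_one (by linarith)).2 hs'
  have h4 : (1 + 1 / (s : ℝ)) ^ (k + 1) ≤ (1 + 1 / (s : ℝ)) ^ k * 2 := by
    rw [pow_succ]
    gcongr
    linarith
  have h5 : (1 / β) ^ 4 / 2 ≤ (1 + 1 / (s : ℝ)) ^ k := by linarith
  have h6 : 2 * (n : ℝ) ≤ β ^ 3 * ((1 / β) ^ 4 / 2) := by
    have : β ^ 3 * ((1 / β) ^ 4 / 2) = 1 / β / 2 := by field_simp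
    rw [this, hβ, one_div_div, div_div, le_div_iff₀ (by positivity)]
    nlinarith
  exact h6.trans (mul_le_mul_of_nonneg_left h5 (by positivity))

theorem pow_le_one_add {n : ℕ} {α : ℝ} (hn : 0 < n) (hα : 0 < α) (hα1 : α < 1) :
    (1 + α / (4 * n)) ^ (2 * n) ≤ 1 + α := by
  have hn' : (0 : ℝ) < n := by exact_mod_cast hn
  calc (1 + α / (4 * n)) ^ (2 * n) ≤ Real.exp (α / (4 * n)) ^ (2 * n) := by
        gcongr
        rw [add_comm]
        exact Real.add_one_le_exp _
    _ = Real.exp (α / 2) := by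
        rw [← Real.exp_nat_mul]
        congr 1
        push_cast
        field_simp
        norm_num
    _ ≤ 1 / (1 - α / 2) := Real.exp_bound_div_one_sub_of_interval (by positivity) (by linarith)
    _ ≤ 1 + α := by
        rw [div_le_iff₀ (by linarith)]
        nlinarith

/-- If the truncated recursion succeeds for the weights `(1 + α) p`, then `p` is in the Shearer
region. -/
theorem mem_region_of_clip_pos {n : ℕ} (G : SimpleGraph (Fin n)) {p : Fin n → ℝ} {α : ℝ}
    (hp : ∀ v, 0 < p v ∧ p v < 1) (hα : 0 < α) (hα1 : α < 1) {s L h : ℕ} (hs1 : 1 ≤ s)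
    (hs : 4 * (n : ℝ) ≤ s * s * α) (hL : 4 * (n : ℝ) ≤ 2 ^ L * α) (hh : h = 4 * s * L)
    (hpos : ∀ a, 0 < clip (((1 + α) • p) a)
      (truncProd G.Adj ((1 + α) • p) h a (Finset.univ.filter (a < ·)))) :
    p ∈ region G := by
  refine ⟨hp, ?_⟩
  -- β = α/(4n) is meaningless for n = 0, where only the empty set has to be checked.
  rcases Nat.eq_zero_or_pos n with rfl | hn
  · intro S
    rw [Finset.eq_empty_of_isEmpty S, altIndepPoly_empty]
    exact one_pos
  have hn' : (1 : ℝ) ≤ n := by exact_mod_cast hn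
  have hs' : (1 : ℝ) ≤ s := by exact_mod_cast hs1
  set β := α / (4 * n) with hβ
  have hβ0 : 0 < β := by positivity
  have hβ1 : β ≤ 1 := (div_le_one (by positivity)).2 (by linarith)
  have hη : (1 / (s : ℝ)) ^ 2 ≤ β := by
    rw [hβ, div_pow, one_pow, div_le_div_iff₀ (by positivity) (by positivity)]
    nlinarith
  -- The depth is positive: L = 0 would give 4n ≤ α < 1.
  obtain ⟨k, rfl⟩ : ∃ k, h = k + 1 := by
    rcases Nat.eq_zero_or_pos L with rfl | hL0
    · rw [pow_zero] at hL
      linarith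
    · exact ⟨h - 1, by have := Nat.mul_pos (by omega : 0 < 4 * s) hL0; omega⟩
  have hk := two_mul_le_pow_of_depth hn hα hα1 hs1 hL hh.ge
  have hp0 : ∀ v, 0 < p v := fun v => (hp v).1
  -- Vertices enter in decreasing order, so that the set present when a enters is the set a < · of
  -- its test; each entry divides the weights by (1+β)².
  have main : ∀ i ≤ n, PosOn G (((1 + α) / (1 + β) ^ (2 * i)) • p)
      (Finset.univ.filter fun c : Fin n => n - i ≤ (c : ℕ)) := by
    intro i
    induction i with
    | zero =>
      intro _ T hT
      have : T = ∅ := by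
        rw [Finset.eq_empty_iff_forall_notMem]
        intro c hc
        have := (Finset.mem_filter.1 (hT hc)).2
        have := c.2
        omega
      rw [this, altIndepPoly_empty]
      exact one_pos
    | succ i ih =>
      intro hi
      have ih := ih (by omega)
      set a : Fin n := ⟨n - (i + 1), by omega⟩ with ha
      have e1 : (Finset.univ.filter fun c : Fin n => n - i ≤ (c : ℕ)) =
          Finset.univ.filter (a < ·) := by
        ext c
        simp only [Finset.mem_filter, Finset.mem_univ, true_and, Fin.lt_def, ha]
        omega
      have e2 : (Finset.univ.filter fun c : Fin n => n - (i + 1) ≤ (c : ℕ)) =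
          insert a (Finset.univ.filter (a < ·)) := by
        ext c
        simp only [Finset.mem_filter, Finset.mem_univ, true_and, Finset.mem_insert, Fin.lt_def,
          Fin.ext_iff, ha]
        omega
      rw [e1] at ih
      rw [e2]
      have e3 : (1 + β) * (1 + β) * ((1 + α) / (1 + β) ^ (2 * (i + 1))) =
          (1 + α) / (1 + β) ^ (2 * i) := by
        rw [Nat.mul_add, pow_add]
        field_simp
      refine posOn_insert_of_clip_pos (p' := (1 + α) • p) hβ0 hβ1 (by positivity) hη ?_ ?_
        (by simp) (N := n) ?_ hk ?_ (hpos a)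
      · intro v
        have := hp0 v
        simp only [Pi.smul_apply, smul_eq_mul]
        positivity
      · intro v
        simp only [Pi.smul_apply, smul_eq_mul]
        rw [← mul_assoc]
        refine mul_le_mul_of_nonneg_right ?_ (hp0 v).le
        have h1 : (1 : ℝ) ≤ (1 + β) ^ (2 * i) := one_le_pow₀ (by linarith)
        have h2 : (1 + α) / (1 + β) ^ (2 * i) ≤ 1 + α := div_le_self (by linarith) h1
        have h3 : 0 ≤ (1 + β) * ((1 + α) / (1 + β) ^ (2 * (i + 1))) := by positivity
        nlinarith
      · exact_mod_cast (Finset.card_le_univ _).trans (by simp)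
      · rwa [smul_smul, smul_smul, e3]
  have hlast := main n le_rfl
  intro S
  refine hlast.anti (fun v => (hp0 v).le) (fun v => ?_) S fun c _ => by simp
  simp only [Pi.smul_apply, smul_eq_mul]
  refine le_mul_of_one_le_left (hp0 v).le ((one_le_div (by positivity)).2 ?_)
  exact pow_le_one_add hn hα hα1

theorem clip_pos_of_mem_region {n : ℕ} (G : SimpleGraph (Fin n)) {p : Fin n → ℝ}
    (h : p ∈ region G) (k : ℕ) (a : Fin n) :
    0 < clip (p a) (truncProd G.Adj p k a (Finset.univ.filter (a < ·))) :=
  clip_truncProd_pos (fun v => (h.1 v).1.le) k (by simp) fun T _ => h.2 T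

end Shearer

namespace Shearer

/-! ### The truncated recursion on initial segments of the natural numbers -/

/-- Moves the recursion from `Fin n` to the natural numbers, which the program works with. -/
theorem truncProd_map {V W : Type*} [LinearOrder V] [LinearOrder W] (e : V ↪o W)
    {adj : V → V → Prop} {adj' : W → W → Prop} {p : V → ℝ} {p' : W → ℝ}
    (hadj : ∀ a b, adj' (e a) (e b) ↔ adj a b) (hp : ∀ a, p' (e a) = p a) (k : ℕ) :
    ∀ (a : V) (S : Finset V),
      truncProd adj' p' k (e a) (S.map e.toEmbedding) = truncProd adj p k a S := by
  classical
  induction k with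
  | zero => exact fun _ _ => rfl
  | succ k ih =>
    intro a S
    have h1 : nbr adj' (e a) (S.map e.toEmbedding) = (nbr adj a S).map e.toEmbedding := by
      ext c
      simp only [mem_nbr, Finset.mem_map]
      constructor
      · rintro ⟨⟨b, hb, rfl⟩, h⟩
        exact ⟨b, ⟨hb, (hadj _ _).1 h⟩, rfl⟩
      · rintro ⟨b, ⟨hb, h⟩, rfl⟩
        exact ⟨⟨b, hb, rfl⟩, (hadj _ _).2 h⟩
    have h2 : ∀ b, rest adj' (e a) (S.map e.toEmbedding) (e b) =
        (rest adj a S b).map e.toEmbedding := by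
      intro b
      ext c
      simp only [rest, Finset.mem_filter, Finset.mem_map]
      constructor
      · rintro ⟨⟨d, hd, rfl⟩, h⟩
        exact ⟨d, ⟨hd, fun h' => h ⟨(hadj _ _).2 h'.1, e.le_iff_le.2 h'.2⟩⟩, rfl⟩
      · rintro ⟨d, ⟨hd, h⟩, rfl⟩
        exact ⟨⟨d, hd, rfl⟩, fun h' => h ⟨(hadj _ _).1 h'.1, e.le_iff_le.1 h'.2⟩⟩
    rw [truncProd, truncProd, h1, Finset.prod_map]
    refine Finset.prod_congr rfl fun b _ => ?_
    rw [RelEmbedding.coe_toEmbedding, h2, ih, hp]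

/-- The graph `G` on `0, …, n - 1`, with an additional vertex `n` from which there is an arrow to
every vertex of `G`. -/
def rootedAdj {n : ℕ} (G : SimpleGraph (Fin n)) (a b : ℕ) : Prop :=
  (a = n ∧ b < n) ∨ ∃ i j : Fin n, a = i ∧ b = j ∧ G.Adj i j

theorem rootedAdj_coe {n : ℕ} (G : SimpleGraph (Fin n)) (i j : Fin n) :
    rootedAdj G i j ↔ G.Adj i j := by
  constructor
  · rintro (⟨h, -⟩ | ⟨i', j', h1, h2, h⟩)
    · exact absurd i.2 (by omega)
    · rwa [Fin.ext h1, Fin.ext h2]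
  · exact fun h => Or.inr ⟨i, j, rfl, rfl, h⟩

theorem rootedAdj.lt {n : ℕ} {G : SimpleGraph (Fin n)} {a b : ℕ} (h : rootedAdj G a b) : b < n := by
  rcases h with ⟨-, h⟩ | ⟨i, j, -, rfl, -⟩
  · exact h
  · exact j.2

/-- The neighbours of the root are removed in increasing order, so the child a of the root is left
with exactly the vertices above a. -/
theorem truncProd_root {n : ℕ} (G : SimpleGraph (Fin n)) {p : Fin n → ℝ} {x : ℕ → ℝ}
    (hx : ∀ v : Fin n, x v = p v) (k : ℕ) :
    truncProd (rootedAdj G) x (k + 1) n (Finset.range n) =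
      ∏ a : Fin n, clip (p a) (truncProd G.Adj p k a (Finset.univ.filter (a < ·))) := by
  have h1 : nbr (rootedAdj G) n (Finset.range n) = Finset.range n := by
    ext b
    simp only [mem_nbr, Finset.mem_range]
    exact ⟨fun h => h.1, fun h => ⟨h, Or.inl ⟨rfl, h⟩⟩⟩
  rw [truncProd, h1, Finset.prod_range]
  refine Finset.prod_congr rfl fun a _ => ?_
  have h2 : rest (rootedAdj G) n (Finset.range n) a =
      (Finset.univ.filter (a < ·)).map (Fin.valOrderEmb n).toEmbedding := by
    ext c
    simp only [rest, Finset.mem_filter, Finset.mem_range, Finset.mem_map, Finset.mem_univ, true_and]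
    constructor
    · rintro ⟨hc, h⟩
      refine ⟨⟨c, hc⟩, ?_, rfl⟩
      rw [Fin.lt_def]
      by_contra h'
      exact h ⟨Or.inl ⟨rfl, hc⟩, not_lt.1 h'⟩
    · rintro ⟨d, hd, rfl⟩
      exact ⟨d.2, fun h => absurd h.2 (not_le.2 hd)⟩
  rw [h2, hx, ← truncProd_map (Fin.valOrderEmb n) (p' := x) (rootedAdj_coe G) hx]
  rfl

/-- No arrow leads into the root, so its n children multiply the running time by n only once; all
deeper branching is by the degree. -/
theorem card_nbr_rootedAdj_le {n : ℕ} (G : SimpleGraph (Fin n)) [DecidableRel G.Adj] {a : ℕ}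
    (ha : a < n) (S : Finset ℕ) : (nbr (rootedAdj G) a S).card ≤ G.maxDegree := by
  refine le_trans ?_ (G.degree_le_maxDegree ⟨a, ha⟩)
  rw [← G.card_neighborFinset_eq_degree, ← Finset.card_map Fin.valEmbedding]
  refine Finset.card_le_card fun b hb => ?_
  obtain ⟨h, -⟩ | ⟨i, j, h1, rfl, h⟩ := (mem_nbr.1 hb).2
  · omega
  · subst h1
    exact Finset.mem_map.2 ⟨j, by simpa using h, rfl⟩

/-! ### Depth-first evaluation of the recursion with an explicit stack -/

/-- The stack: the frame `i` holds a vertex, a pointer to the next candidate for a child, the set of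
the available vertices and the product of the values of the children up to now. Children of the
frame `i` are evaluated in the frame `i - 1`, and `level` is the active frame. -/
structure Stack where
  level : ℕ
  vert : ℕ → ℕ
  ptr : ℕ → ℕ
  set : ℕ → Finset ℕ
  prod : ℕ → ℝ

namespace Stack

/-- Start the evaluation of a child. -/
noncomputable def push (σ : Stack) : Stack where
  level := σ.level - 1
  vert := Function.update σ.vert (σ.level - 1) (σ.ptr σ.level)
  ptr := Function.update (Function.update σ.ptr σ.level (σ.ptr σ.level + 1)) (σ.level - 1) 0
  set := Function.update (Function.update σ.set σ.level ((σ.set σ.level).erase (σ.ptr σ.level)))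
    (σ.level - 1) ((σ.set σ.level).erase (σ.ptr σ.level))
  prod := Function.update σ.prod (σ.level - 1) 1

/-- Go on to the next candidate. -/
noncomputable def next (σ : Stack) : Stack :=
  { σ with ptr := Function.update σ.ptr σ.level (σ.ptr σ.level + 1) }

/-- Return the value of the active frame. -/
noncomputable def pop (x : ℕ → ℝ) (σ : Stack) : Stack :=
  { σ with
    level := σ.level + 1
    prod := Function.update σ.prod (σ.level + 1)
      (σ.prod (σ.level + 1) * clip (x (σ.vert σ.level)) (σ.prod σ.level)) }

open Classical in
/-- One step of the evaluation. -/
noncomputable def step (n : ℕ) (adj : ℕ → ℕ → Prop) (x : ℕ → ℝ) (σ : Stack) : Stack :=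
  if 1 ≤ σ.level ∧ σ.ptr σ.level < n then
    if adj (σ.vert σ.level) (σ.ptr σ.level) ∧ σ.ptr σ.level ∈ σ.set σ.level then σ.push else σ.next
  else σ.pop x

/-- The evaluation is complete. -/
def Halted (n K : ℕ) (σ : Stack) : Prop := K ≤ σ.level ∧ n ≤ σ.ptr σ.level

/-- `Reach n adj x K N σ σ'`: at most `N` steps lead from `σ` to `σ'`. -/
inductive Reach (n : ℕ) (adj : ℕ → ℕ → Prop) (x : ℕ → ℝ) (K : ℕ) : ℕ → Stack → Stack → Prop
  | refl (N : ℕ) (σ : Stack) : Reach n adj x K N σ σ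
  | head {N : ℕ} {σ σ' : Stack} : ¬ σ.Halted n K → Reach n adj x K N (σ.step n adj x) σ' →
      Reach n adj x K (N + 1) σ σ'

variable {n : ℕ} {adj : ℕ → ℕ → Prop} {x : ℕ → ℝ} {K : ℕ}

theorem Reach.mono {N M : ℕ} {σ σ' : Stack} (h : Reach n adj x K N σ σ') (hNM : N ≤ M) :
    Reach n adj x K M σ σ' := by
  induction h generalizing M with
  | refl => exact .refl _ _
  | head h0 _ ih =>
    obtain ⟨M, rfl⟩ := Nat.exists_eq_add_of_le hNM
    rw [Nat.add_right_comm]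
    exact .head h0 (ih (by omega))

theorem Reach.trans {N M : ℕ} {σ σ' σ'' : Stack} (h : Reach n adj x K N σ σ')
    (h' : Reach n adj x K M σ' σ'') : Reach n adj x K (N + M) σ σ'' := by
  induction h with
  | refl => exact h'.mono (by omega)
  | head h0 _ ih =>
    rw [Nat.add_right_comm]
    exact .head h0 (ih h')

theorem Reach.single {σ : Stack} (h : ¬ σ.Halted n K) : Reach n adj x K 1 σ (σ.step n adj x) :=
  .head h (.refl 0 _)

/-- The stacks agree above the frame `k`. -/
def AgreeAbove (k : ℕ) (σ σ' : Stack) : Prop :=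
  ∀ i, k < i → σ'.vert i = σ.vert i ∧ σ'.ptr i = σ.ptr i ∧ σ'.set i = σ.set i ∧
    σ'.prod i = σ.prod i

/-- A bound for the number of steps that evaluate a frame and return its value. -/
def frameSteps (n d : ℕ) : ℕ → ℕ
  | 0 => 1
  | k + 1 => n + d * frameSteps n d k + 1

/-- The shift by n + 1 absorbs the additive term of the recursion as soon as d ≥ 2. -/
theorem frameSteps_add_le {d : ℕ} (hd : 2 ≤ d) (k : ℕ) :
    frameSteps n d k + (n + 1) ≤ (n + 1) * d ^ (k + 1) := by
  induction k with
  | zero =>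
    rw [frameSteps, zero_add, pow_one]
    have := Nat.mul_le_mul_left (n + 1) hd
    omega
  | succ k ih =>
    rw [frameSteps, pow_succ]
    have := Nat.mul_le_mul_left d ih
    nlinarith

/-- The result of evaluating the frame `k`. -/
def Returns (n : ℕ) (adj : ℕ → ℕ → Prop) (x : ℕ → ℝ) (K k N : ℕ) (σ : Stack) : Prop :=
  ∃ σ', Reach n adj x K N σ σ' ∧ σ'.level = k + 1 ∧
    σ'.vert (k + 1) = σ.vert (k + 1) ∧ σ'.ptr (k + 1) = σ.ptr (k + 1) ∧
    σ'.set (k + 1) = σ.set (k + 1) ∧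
    σ'.prod (k + 1) = σ.prod (k + 1) * clip (x (σ.vert k)) (truncProd adj x k (σ.vert k) (σ.set k)) ∧
    AgreeAbove (k + 1) σ σ'

-- Loop invariant of the pointer at position j: the neighbours below j have been multiplied in and
-- erased from the set of the frame. Each candidate costs one step, each actual child U more.
open Classical in
theorem scan {k U : ℕ}
    (hchild : ∀ σ : Stack, σ.level = k → σ.vert k < n → σ.ptr k = 0 → σ.prod k = 1 →
      Returns n adj x K k U σ)
    {σ : Stack} (hl : σ.level = k + 1) (h0 : σ.ptr (k + 1) = 0) :
    ∀ j ≤ n, ∃ σ', Reach n adj x K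
        (j + ((nbr adj (σ.vert (k + 1)) (σ.set (k + 1))).filter (· < j)).card * U) σ σ' ∧
      σ'.level = k + 1 ∧ σ'.ptr (k + 1) = j ∧ σ'.vert (k + 1) = σ.vert (k + 1) ∧
      σ'.set (k + 1) = (σ.set (k + 1)).filter (fun c => ¬ (adj (σ.vert (k + 1)) c ∧ c < j)) ∧
      σ'.prod (k + 1) = σ.prod (k + 1) *
        ∏ b ∈ (nbr adj (σ.vert (k + 1)) (σ.set (k + 1))).filter (· < j),
          clip (x b) (truncProd adj x k b (rest adj (σ.vert (k + 1)) (σ.set (k + 1)) b)) ∧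
      AgreeAbove (k + 1) σ σ' := by
  intro j
  set a := σ.vert (k + 1) with ha
  set S := σ.set (k + 1) with hS
  induction j with
  | zero =>
    intro _
    exact ⟨σ, .refl _ _, hl, h0, rfl, by simp [← hS], by simp, fun _ _ => ⟨rfl, rfl, rfl, rfl⟩⟩
  | succ j ih =>
    intro hj
    obtain ⟨τ, hr, tl, tp, tv, ts, tprod, tag⟩ := ih (by omega)
    have hnh : ¬ τ.Halted n K := by
      rintro ⟨-, h⟩
      rw [tl, tp] at h
      omega
    have hstep : τ.step n adj x = if adj a j ∧ j ∈ τ.set (k + 1) then τ.push else τ.next := by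
      rw [step, tl, tp, tv, if_pos ⟨by omega, by omega⟩]
    have hmem : j ∈ τ.set (k + 1) ↔ j ∈ S := by
      simp [ts]
    by_cases hc : adj a j ∧ j ∈ S
    · have hstep' : τ.step n adj x = τ.push := by rw [hstep, if_pos ⟨hc.1, hmem.2 hc.2⟩]
      have hpl : τ.push.level = k := by simp [push, tl]
      have hpv : τ.push.vert k = j := by simp [push, tl, tp]
      -- Earlier neighbours were erased from the parent's own set, so erasing j leaves exactly the
      -- set that the recursion assigns to the child j.
      have hps : (τ.set (k + 1)).erase j = rest adj a S j := by
        ext c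
        simp only [ts, rest, Finset.mem_erase, Finset.mem_filter]
        constructor
        · rintro ⟨h1, h2, h3⟩
          exact ⟨h2, fun h => h3 ⟨h.1, lt_of_le_of_ne h.2 h1⟩⟩
        · rintro ⟨h2, h3⟩
          refine ⟨?_, h2, fun h => h3 ⟨h.1, h.2.le⟩⟩
          rintro rfl
          exact h3 ⟨hc.1, le_rfl⟩
      have hpset : τ.push.set k = rest adj a S j := by simp [push, tl, tp, hps]
      obtain ⟨ρ, rr, rl, rv, rp, rs, rprod, rag⟩ := hchild τ.push hpl (by omega)
        (by simp [push, tl]) (by simp [push, tl])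
      have hne : k + 1 ≠ k := by omega
      have hfil : (nbr adj a S).filter (· < j + 1) = insert j ((nbr adj a S).filter (· < j)) := by
        ext c
        simp only [Finset.mem_filter, Finset.mem_insert, mem_nbr]
        constructor
        · rintro ⟨h1, h2⟩
          by_cases h : c = j
          · exact Or.inl h
          · exact Or.inr ⟨h1, by omega⟩
        · rintro (rfl | ⟨h1, h2⟩)
          · exact ⟨⟨hc.2, hc.1⟩, by omega⟩
          · exact ⟨h1, by omega⟩
      have hnot : j ∉ (nbr adj a S).filter (· < j) := by simp
      refine ⟨ρ, ?_, rl, ?_, ?_, ?_, ?_, ?_⟩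
      · refine (hr.trans (.head hnh (hstep' ▸ rr))).mono ?_
        rw [hfil, Finset.card_insert_of_notMem hnot, add_mul]
        omega
      · rw [rp]; simp [push, tl, tp]
      · rw [rv]; simp [push, tl, tv]
      · rw [rs]
        simp only [push, tl, tp, Nat.add_sub_cancel, Function.update_of_ne hne,
          Function.update_self, hps]
        ext c
        simp only [rest, Finset.mem_filter, Nat.lt_succ_iff]
      · rw [rprod, hpv, hpset, hfil, Finset.prod_insert hnot]
        simp only [push, tl, Nat.add_sub_cancel, Function.update_of_ne hne, tprod]
        ring
      · intro i hi
        obtain ⟨h1, h2, h3, h4⟩ := rag i hi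
        obtain ⟨g1, g2, g3, g4⟩ := tag i hi
        have i1 : i ≠ k := by omega
        have i2 : i ≠ k + 1 := by omega
        rw [h1, h2, h3, h4, ← g1, ← g2, ← g3, ← g4]
        simp [push, tl, i1, i2]
    · have hstep' : τ.step n adj x = τ.next := by
        rw [hstep, if_neg fun h => hc ⟨h.1, hmem.1 h.2⟩]
      have hfil : (nbr adj a S).filter (· < j + 1) = (nbr adj a S).filter (· < j) := by
        ext c
        simp only [Finset.mem_filter, mem_nbr]
        constructor
        · rintro ⟨h1, h2⟩
          refine ⟨h1, lt_of_le_of_ne (Nat.lt_succ_iff.1 h2) ?_⟩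
          rintro rfl
          exact hc ⟨h1.2, h1.1⟩
        · rintro ⟨h1, h2⟩
          exact ⟨h1, by omega⟩
      have h1 := Reach.single (adj := adj) (x := x) hnh
      rw [hstep'] at h1
      refine ⟨τ.next, (hr.trans h1).mono ?_, ?_, ?_, ?_, ?_, ?_, ?_⟩
      · rw [hfil]; omega
      · simp [next, tl]
      · simp [next, tl, tp]
      · simp [next, tv]
      · simp only [next, ts]
        ext c
        simp only [Finset.mem_filter]
        refine and_congr_right fun hcS => not_congr ⟨fun h => ⟨h.1, by omega⟩, fun h => ⟨h.1, ?_⟩⟩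
        refine lt_of_le_of_ne (Nat.lt_succ_iff.1 h.2) ?_
        rintro rfl
        exact hc ⟨h.1, hcS⟩
      · rw [hfil]
        exact tprod
      · intro i hi
        obtain ⟨g1, g2, g3, g4⟩ := tag i hi
        have i2 : i ≠ k + 1 := by omega
        simp [next, tl, i2, g1, g2, g3, g4]

theorem filter_nbr_lt (hadj : ∀ a b, adj a b → b < n) (a : ℕ) (S : Finset ℕ) :
    (nbr adj a S).filter (· < n) = nbr adj a S :=
  Finset.filter_true_of_mem fun _ hb => hadj _ _ (mem_nbr.1 hb).2

/-- The frame number is the remaining depth. Frame 0 pops at once with the empty product 1; a higher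
frame scans its candidates and then pops. As k < K, the halting condition cannot interfere. -/
theorem returns {d : ℕ} (hadj : ∀ a b, adj a b → b < n)
    (hd : ∀ a < n, ∀ S, (nbr adj a S).card ≤ d) (k : ℕ) :
    ∀ σ : Stack, k < K → σ.level = k → σ.vert k < n → σ.ptr k = 0 → σ.prod k = 1 →
      Returns n adj x K k (frameSteps n d k) σ := by
  have hpop : ∀ (k N : ℕ) (σ τ : Stack), k < K → Reach n adj x K N σ τ → τ.level = k →
      (k = 0 ∨ τ.ptr k = n) → τ.vert k = σ.vert k →
      τ.prod k = truncProd adj x k (σ.vert k) (σ.set k) → AgreeAbove k σ τ →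
      Returns n adj x K k (N + 1) σ := by
    intro k N σ τ hk hr tl tp tv tprod tag
    have hnh : ¬ τ.Halted n K := by
      rintro ⟨h, -⟩
      omega
    have hstep : τ.step n adj x = τ.pop x := by
      rw [step, if_neg]
      rw [tl]
      omega
    have h1 := Reach.single (adj := adj) (x := x) hnh
    rw [hstep] at h1
    obtain ⟨g1, g2, g3, g4⟩ := tag (k + 1) (by omega)
    refine ⟨τ.pop x, hr.trans h1, by simp [pop, tl], g1, g2, g3, ?_, ?_⟩
    · simp [pop, tl, tv, tprod, g4]
    · intro i hi
      obtain ⟨g1, g2, g3, g4⟩ := tag i (by omega)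
      have i2 : i ≠ k + 1 := by omega
      simp [pop, tl, i2, g1, g2, g3, g4]
  induction k with
  | zero =>
    intro σ hk hl hv hp hprod
    exact hpop 0 0 σ σ hk (.refl _ _) hl (Or.inl rfl) rfl hprod fun _ _ => ⟨rfl, rfl, rfl, rfl⟩
  | succ k ih =>
    intro σ hk hl hv hp hprod
    obtain ⟨τ, hr, tl, tp, tv, -, tprod, tag⟩ :=
      scan (U := frameSteps n d k) (fun σ => ih σ (by omega)) hl hp n le_rfl
    rw [filter_nbr_lt hadj] at hr tprod
    refine hpop (k + 1) _ σ τ hk (hr.mono ?_) tl (Or.inr tp) tv ?_ tag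
    · exact Nat.add_le_add_left (Nat.mul_le_mul_right _ (hd _ hv _)) _
    · rw [tprod, hprod, one_mul, truncProd]

/-- The evaluation of the whole recursion. -/
theorem reach_root {d k : ℕ} (hadj : ∀ a b, adj a b → b < n)
    (hd : ∀ a < n, ∀ S, (nbr adj a S).card ≤ d) {σ : Stack} {S : Finset ℕ}
    (hS : S ⊆ Finset.range n) (hl : σ.level = k + 1) (hv : σ.vert (k + 1) = n)
    (hp : σ.ptr (k + 1) = 0) (hs : σ.set (k + 1) = S) (hprod : σ.prod (k + 1) = 1) :
    ∃ σ', Reach n adj x (k + 1) (n + n * frameSteps n d k) σ σ' ∧ σ'.Halted n (k + 1) ∧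
      σ'.prod (k + 1) = truncProd adj x (k + 1) n S := by
  obtain ⟨τ, hr, tl, tp, -, -, tprod, -⟩ :=
    scan (K := k + 1) (x := x) (U := frameSteps n d k)
      (fun σ => returns hadj hd k σ (by omega)) hl hp n le_rfl
  rw [filter_nbr_lt hadj, hv, hs] at hr tprod
  refine ⟨τ, hr.mono ?_, ⟨tl.ge, by rw [tl, tp]⟩, by rw [tprod, hprod, one_mul, truncProd]⟩
  refine Nat.add_le_add_left (Nat.mul_le_mul_right _ ?_) _
  -- The degree bound does not apply to the root, which has at most n children.
  calc (nbr adj n S).card ≤ (Finset.range n).card :=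
        Finset.card_le_card fun b hb => hS (mem_nbr.1 hb).1
    _ = n := Finset.card_range n

end Stack

end Shearer

/-! ### Time-bounded correctness of programs -/

namespace RealRAM

/-- `P`, started with memory `m`, halts after at most `T` steps with a memory that satisfies `Q`. -/
def Runs (P : Program) (m : Memory) (T : ℕ) (Q : Memory → Prop) : Prop :=
  ∃ t m', Exec P m t m' ∧ t ≤ T ∧ Q m'

namespace Runs

theorem mono {P : Program} {m : Memory} {T T' : ℕ} {Q Q' : Memory → Prop} (h : Runs P m T Q)
    (hT : T ≤ T') (hQ : ∀ m', Q m' → Q' m') : Runs P m T' Q' := by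
  obtain ⟨t, m', he, ht, hq⟩ := h
  exact ⟨t, m', he, ht.trans hT, hQ _ hq⟩

theorem setNat {a : ℕ} {e f : NatExpr} {m : Memory} {Q : Memory → Prop}
    (h : Q (m.setNat a (e.eval m) (f.eval m))) :
    Runs (.setNat a e f) m (e.cost + f.cost + 1) Q :=
  ⟨_, _, .setNat a e f m, le_rfl, h⟩

theorem setReal {a : ℕ} {e : NatExpr} {f : RealExpr} {m : Memory} {Q : Memory → Prop}
    (h : Q (m.setReal a (e.eval m) (f.eval m))) :
    Runs (.setReal a e f) m (e.cost + f.cost + 1) Q :=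
  ⟨_, _, .setReal a e f m, le_rfl, h⟩

theorem seq {P R : Program} {m : Memory} {T T' : ℕ} {Q : Memory → Prop}
    (h : Runs P m T fun m' => Runs R m' T' Q) : Runs (.seq P R) m (T + T') Q := by
  obtain ⟨t, m', he, ht, t', m'', he', ht', hq⟩ := h
  exact ⟨_, _, .seq he he', add_le_add ht ht', hq⟩

theorem ite {b : Test} {P R : Program} {m : Memory} {T : ℕ} {Q : Memory → Prop}
    (h₁ : b.Holds m → Runs P m T Q) (h₂ : ¬ b.Holds m → Runs R m T Q) :
    Runs (.ite b P R) m (b.cost + 1 + T) Q := by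
  by_cases hb : b.Holds m
  · obtain ⟨t, m', he, ht, hq⟩ := h₁ hb
    exact ⟨_, _, .iteTrue hb he, by omega, hq⟩
  · obtain ⟨t, m', he, ht, hq⟩ := h₂ hb
    exact ⟨_, _, .iteFalse hb he, by omega, hq⟩

/-- A loop which is executed exactly `N` times. -/
theorem while_count {b : Test} {P : Program} {T : ℕ} (I : ℕ → Memory → Prop) (N : ℕ)
    (hstep : ∀ i < N, ∀ m, I i m → b.Holds m ∧ Runs P m T (I (i + 1)))
    (hend : ∀ m, I N m → ¬ b.Holds m) {m : Memory} (h0 : I 0 m) :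
    Runs (.while b P) m (N * (b.cost + 1 + T) + (b.cost + 1)) (I N) := by
  -- Induction on the number k of iterations still to come.
  have main : ∀ k ≤ N, ∀ m, I (N - k) m →
      Runs (.while b P) m (k * (b.cost + 1 + T) + (b.cost + 1)) (I N) := by
    intro k
    induction k with
    | zero => exact fun _ m hm => ⟨_, m, .whileFalse (hend m hm), by omega, hm⟩
    | succ k ih =>
      intro hk m hm
      obtain ⟨hb, t, m', he, ht, hq⟩ := hstep _ (by omega) m hm
      rw [show N - (k + 1) + 1 = N - k by omega] at hq
      obtain ⟨t', m'', he', ht', hq'⟩ := ih (by omega) m' hq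
      refine ⟨_, m'', .whileTrue hb he he', ?_, hq'⟩
      rw [add_mul]
      omega
  exact main N le_rfl m (by simpa using h0)

end Runs

/-- Cell `0` of a natural array. -/
def reg (a : ℕ) : NatExpr := .read a (.const 0)

/-- Cell `0` of a real array. -/
def realReg (a : ℕ) : RealExpr := .read a (.const 0)

@[simp] theorem eval_reg (a : ℕ) (m : Memory) : (reg a).eval m = m.nat a 0 := rfl

@[simp] theorem cost_reg (a : ℕ) : (reg a).cost = 2 := rfl

@[simp] theorem eval_realReg (a : ℕ) (m : Memory) : (realReg a).eval m = m.real a 0 := rfl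

@[simp] theorem cost_realReg (a : ℕ) : (realReg a).cost = 2 := rfl

/-- Execute `P` while the counter, cell `0` of array `c`, runs from `0` to `bound - 1`. -/
def forLoop (c : ℕ) (bound : NatExpr) (P : Program) : Program :=
  .seq (.setNat c (.const 0) (.const 0))
    (.while (.natLe (.add (reg c) (.const 1)) bound)
      (.seq P (.setNat c (.const 0) (.add (reg c) (.const 1)))))

theorem Runs.forLoop {c : ℕ} {bound : NatExpr} {P : Program} {T : ℕ} (I : ℕ → Memory → Prop)
    (N : ℕ) {m : Memory} (h0 : I 0 (m.setNat c 0 0)) (hb : ∀ i m, I i m → bound.eval m = N)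
    (hstep : ∀ i < N, ∀ m, I i m → m.nat c 0 = i →
      Runs P m T fun m' => m'.nat c 0 = i ∧ I (i + 1) (m'.setNat c 0 (i + 1))) :
    Runs (forLoop c bound P) m (N * (T + bound.cost + 12) + bound.cost + 9) (I N) := by
  -- An iteration costs T, 6 for the increment and `bound.cost` + 6 for the guard; the remaining
  -- `bound.cost` + 9 are the initialization and the last, failing guard.
  refine (Runs.seq (Runs.setNat (Runs.while_count (T := T + (1 + 4 + 1))
    (fun i m => m.nat c 0 = i ∧ I i m) N ?_ ?_ ⟨?_, h0⟩))).mono ?_ fun m' h => h.2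
  · rintro i hi m ⟨hc, hI⟩
    refine ⟨?_, Runs.seq ((hstep i hi m hI hc).mono le_rfl ?_)⟩
    · simp only [Test.Holds, NatExpr.eval, eval_reg, hc, hb i m hI]
      omega
    · rintro m' ⟨hc', hI'⟩
      refine Runs.setNat ?_
      simp only [NatExpr.eval, eval_reg, hc']
      refine ⟨by simp [Memory.setNat], hI'⟩
  · rintro m ⟨hc, hI⟩
    simp only [Test.Holds, NatExpr.eval, eval_reg, hc, hb N m hI]
    omega
  · simp [Memory.setNat, NatExpr.eval]
  · simp only [NatExpr.cost, Test.cost, cost_reg]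
    ring_nf
    omega

/-! ### The program for one step of the evaluation -/

/-- The active frame. -/
def levelE : NatExpr := reg 7

/-- The index in a matrix with rows of length `n`. -/
def cellE (i j : NatExpr) : NatExpr := .add (.read 3 i) j

/-- The vertex of the active frame. -/
def vertE : NatExpr := .read 4 levelE

/-- The pointer of the active frame. -/
def ptrE : NatExpr := .read 5 levelE

/-- The weight of the vertex of the active frame. -/
def weightE : RealExpr := .mul (.add (.const 1) (realReg 1)) (.read 0 vertE)

/-- Start the evaluation of a child. -/
def pushCode : Program :=
  .seq (.setNat 6 (cellE levelE ptrE) (.const 0)) <|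
  .seq (.setNat 4 (.sub levelE (.const 1)) ptrE) <|
  .seq (.setNat 5 levelE (.add ptrE (.const 1))) <|
  .seq (.setNat 5 (.sub levelE (.const 1)) (.const 0)) <|
  .seq (.setReal 2 (.sub levelE (.const 1)) (.const 1)) <|
  .seq (.setNat 7 (.const 0) (.sub levelE (.const 1))) <|
  forLoop 8 (reg 0) (.setNat 6 (cellE levelE (reg 8))
    (.read 6 (cellE (.add levelE (.const 1)) (reg 8))))

/-- Go on to the next candidate. -/
def nextCode : Program := .setNat 5 levelE (.add ptrE (.const 1))

/-- Return the value of the active frame. -/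
def popCode : Program :=
  .seq (.ite (.realLe (.read 2 levelE) weightE)
      (.setReal 2 (.add levelE (.const 1)) (.const 0))
      (.setReal 2 (.add levelE (.const 1)) (.mul (.read 2 (.add levelE (.const 1)))
        (.sub (.const 1) (.div weightE (.read 2 levelE))))))
    (.setNat 7 (.const 0) (.add levelE (.const 1)))

/-- One step of the evaluation. -/
def stepCode : Program :=
  .ite (.and (.natLe (.const 1) levelE) (.natLe (.add ptrE (.const 1)) (reg 0)))
    (.ite (.and (.natLe (.const 1) (.read 1 (cellE vertE ptrE)))
        (.natLe (.const 1) (.read 6 (cellE levelE ptrE)))) pushCode nextCode)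
    popCode

/-- The memory represents the stack. -/
structure Represents (n : ℕ) (adj : ℕ → ℕ → Prop) (q : ℕ → ℝ) (α : ℝ) (K : ℕ)
    (σ : Shearer.Stack) (m : Memory) : Prop where
  size : m.nat 0 0 = n
  adjacency : ∀ a ≤ n, ∀ b < n, 1 ≤ m.nat 1 (a * n + b) ↔ adj a b
  rows : ∀ i ≤ n + K, m.nat 3 i = i * n
  vert : m.nat 4 = σ.vert
  ptr : m.nat 5 = σ.ptr
  set : ∀ i ≤ K, ∀ v < n, 1 ≤ m.nat 6 (i * n + v) ↔ v ∈ σ.set i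
  level : m.nat 7 0 = σ.level
  depth : m.nat 9 0 = K
  weights : m.real 0 = q
  slack : m.real 1 0 = α
  prod : m.real 2 = σ.prod
  level_le : σ.level ≤ K
  vert_le : ∀ i, σ.vert i ≤ n

theorem row_add_inj {n i j v w : ℕ} (hv : v < n) (hw : w < n) (h : i * n + v = j * n + w) :
    i = j ∧ v = w := by
  have h1 : (i * n + v) / n = i := by
    rw [mul_comm, Nat.mul_add_div (by omega), Nat.div_eq_of_lt hv, add_zero]
  have h2 : (j * n + w) / n = j := by
    rw [mul_comm, Nat.mul_add_div (by omega), Nat.div_eq_of_lt hw, add_zero]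
  have h3 : i = j := by rw [← h1, ← h2, h]
  subst h3
  exact ⟨rfl, by omega⟩

section

variable {n : ℕ} {adj : ℕ → ℕ → Prop} {q : ℕ → ℝ} {α : ℝ} {K : ℕ} {σ : Shearer.Stack} {m : Memory}

theorem runs_nextCode (h : Represents n adj q α K σ m) :
    Runs nextCode m 10 (Represents n adj q α K σ.next) := by
  refine (Runs.setNat ?_).mono (by simp [NatExpr.cost, levelE, ptrE]) fun _ h => h
  have hl := h.level
  have hp := h.ptr
  constructor <;>
    simp [Memory.setNat, NatExpr.eval, levelE, ptrE, Shearer.Stack.next, hl, hp, h.size, h.vert,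
      h.depth, h.weights, h.slack, h.prod, h.level_le, h.vert_le]
  · exact h.adjacency
  · exact h.rows
  · exact h.set

theorem runs_popCode (h : Represents n adj q α K σ m) (hK : σ.level < K) :
    Runs popCode m 60 (Represents n adj q α K (σ.pop fun v => (1 + α) * q v)) := by
  have hl := h.level
  -- Both branches write the updated product; they differ only in whether `clip` vanishes.
  have key : ∀ y, y = σ.prod (σ.level + 1) *
        Shearer.clip ((1 + α) * q (σ.vert σ.level)) (σ.prod σ.level) →
      Represents n adj q α K (σ.pop fun v => (1 + α) * q v)
        ((m.setReal 2 (σ.level + 1) y).setNat 7 0 (σ.level + 1)) := by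
    rintro y rfl
    constructor <;>
      simp [Memory.setNat, Memory.setReal, Shearer.Stack.pop, h.ptr, h.size,
        h.vert, h.depth, h.weights, h.slack, h.prod, h.vert_le]
    · exact h.adjacency
    · exact h.rows
    · exact h.set
    · exact hK
  have hw : weightE.eval m = (1 + α) * q (σ.vert σ.level) := by
    simp [weightE, RealExpr.eval, NatExpr.eval, vertE, levelE, hl, h.vert, h.weights, h.slack]
  refine (Runs.seq (Runs.ite (T := 40) (fun hb => ?_) fun hb => ?_)).mono
    (T := (Test.realLe (.read 2 levelE) weightE).cost + 1 + 40 + 6) ?_ fun _ h => h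
  · refine (Runs.setReal (Runs.setNat ?_)).mono ?_ fun _ h => h
    · convert key _ ?_ using 1
      rotate_left
      · exact 0
      · rw [Test.Holds, hw] at hb
        simp only [RealExpr.eval, levelE, eval_reg, hl, h.prod] at hb
        rw [Shearer.clip, if_neg (not_lt.2 hb), mul_zero]
      · simp [Memory.setNat, Memory.setReal, NatExpr.eval, RealExpr.eval, levelE, hl]
    · simp [NatExpr.cost, RealExpr.cost, levelE]
  · refine (Runs.setReal (Runs.setNat ?_)).mono ?_ fun _ h => h
    · convert key _ rfl using 1
      rw [Test.Holds, hw] at hb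
      simp only [RealExpr.eval, levelE, eval_reg, hl, h.prod] at hb
      rw [Shearer.clip, if_pos (not_le.1 hb)]
      simp [Memory.setNat, Memory.setReal, NatExpr.eval, RealExpr.eval, hw, levelE, hl, h.prod]
    · simp [NatExpr.cost, RealExpr.cost, levelE, vertE, weightE]
  · simp [NatExpr.cost, RealExpr.cost, Test.cost, levelE, vertE, weightE]

theorem runs_pushCode (h : Represents n adj q α K σ m) (hl1 : 1 ≤ σ.level)
    (hj : σ.ptr σ.level < n) :
    Runs pushCode m (100 + 40 * n) (Represents n adj q α K σ.push) := by
  have hl := h.level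
  have hlK := h.level_le
  obtain ⟨k, hk⟩ : ∃ k, σ.level = k + 1 := ⟨σ.level - 1, by omega⟩
  set j := σ.ptr σ.level with hjdef
  have hrow : m.nat 3 σ.level = σ.level * n := h.rows _ (by omega)
  -- After i rounds the first i entries of row k of the set table agree with row k + 1. All other
  -- rows are as before, except that j has been erased from row k + 1.
  let I : ℕ → Memory → Prop := fun i m' =>
    (∀ a, a ∉ [4, 5, 6, 7, 8] → m'.nat a = m.nat a) ∧ (∀ a, a ≠ 2 → m'.real a = m.real a) ∧
    m'.nat 4 = σ.push.vert ∧ m'.nat 5 = σ.push.ptr ∧ m'.nat 7 0 = k ∧ m'.real 2 = σ.push.prod ∧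
    (∀ v < i, m'.nat 6 (k * n + v) = m'.nat 6 ((k + 1) * n + v)) ∧
    ∀ a ≠ k, ∀ v < n, m'.nat 6 (a * n + v) =
      if a = k + 1 ∧ v = j then 0 else m.nat 6 (a * n + v)
  refine (Runs.seq <| Runs.setNat <| Runs.seq <| Runs.setNat <| Runs.seq <| Runs.setNat <|
    Runs.seq <| Runs.setNat <| Runs.seq <| Runs.setReal <| Runs.seq <| Runs.setNat <|
    Runs.forLoop (T := 20) I n ?_ ?_ ?_).mono ?_ ?_
  · refine ⟨?_, ?_, ?_, ?_, ?_, ?_, ?_, ?_⟩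
    · intro a ha
      simp only [List.mem_cons, List.not_mem_nil, or_false, not_or] at ha
      simp [Memory.setNat, Memory.setReal, ha]
    · intro a ha
      simp [Memory.setNat, Memory.setReal, ha]
    · simp [Memory.setNat, Memory.setReal, NatExpr.eval, levelE, ptrE, hl, h.vert, h.ptr,
        Shearer.Stack.push]
    · simp [Memory.setNat, Memory.setReal, NatExpr.eval, levelE, ptrE, hl, h.ptr,
        Shearer.Stack.push]
    · simp [Memory.setNat, Memory.setReal, NatExpr.eval, levelE, hl, hk]
    · simp [Memory.setNat, Memory.setReal, NatExpr.eval, RealExpr.eval, levelE, hl, h.prod,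
        Shearer.Stack.push]
    · simp
    · intro a ha v hv
      have e : ∀ y, y = Function.update (m.nat 6) (σ.level * n + j) 0 →
          y (a * n + v) = if a = k + 1 ∧ v = j then 0 else m.nat 6 (a * n + v) := ?_
      · exact e _ (by simp [Memory.setNat, Memory.setReal, NatExpr.eval, levelE, ptrE, cellE, hl,
          h.ptr, hrow, hjdef])
      rintro y rfl
      rw [Function.update_apply, ← hk]
      refine if_congr ⟨fun e => ?_, fun e => by rw [e.1, e.2]⟩ rfl rfl
      exact row_add_inj hv hj e
  · intro i m' hI
    simpa [h.size] using congrFun (hI.1 0 (by simp)) 0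
  · intro i hi m' hI hc
    obtain ⟨g1, g2, g3, g4, g5, g6, g7, g8⟩ := hI
    have r0 : m'.nat 3 k = k * n := by
      rw [g1 3 (by simp)]; exact h.rows _ (by omega)
    have r1 : m'.nat 3 (k + 1) = (k + 1) * n := by
      rw [g1 3 (by simp)]; exact h.rows _ (by omega)
    refine (Runs.setNat ?_).mono (by simp [NatExpr.cost, cellE, levelE]) fun _ h => h
    simp only [NatExpr.eval, cellE, levelE, eval_reg, g5, hc, r0, r1]
    refine ⟨by simpa [Memory.setNat] using hc, ?_, ?_, ?_, ?_, ?_, ?_, ?_, ?_⟩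
    · intro a ha
      rw [← g1 a ha]
      simp only [List.mem_cons, List.not_mem_nil, or_false, not_or] at ha
      simp [Memory.setNat, ha]
    · exact g2
    · simpa [Memory.setNat] using g3
    · simpa [Memory.setNat] using g4
    · simpa [Memory.setNat] using g5
    · exact g6
    · intro v hv
      have hne : (k + 1) * n + v ≠ k * n + i := fun e => by
        have := (row_add_inj (by omega) hi e).1
        omega
      by_cases hvi : v = i
      · subst hvi
        have := Function.update_of_ne hne (m'.nat 6 ((k + 1) * n + v)) (m'.nat 6)
        simp [Memory.setNat]
        exact this.symm
      · have hne' : k * n + v ≠ k * n + i := by omega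
        have := g7 v (by omega)
        simp [Memory.setNat, hne, hvi, this]
    · intro a ha v hv
      have hne : a * n + v ≠ k * n + i := fun e => ha (row_add_inj hv hi e).1
      simpa [Memory.setNat, hne] using g8 a ha v hv
  · simp only [NatExpr.cost, RealExpr.cost, levelE, ptrE, cellE, cost_reg]
    omega
  · rintro m' ⟨g1, g2, g3, g4, g5, g6, g7, g8⟩
    have hset : ∀ v < n, (1 ≤ m'.nat 6 ((k + 1) * n + v) ↔ v ∈ (σ.set (k + 1)).erase j) := by
      intro v hv
      rw [g8 (k + 1) (by omega) v hv]
      by_cases hvj : v = j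
      · simp [hvj]
      · simpa [hvj] using h.set (k + 1) (by omega) v hv
    constructor
    · rw [g1 0 (by simp)]; exact h.size
    · rw [g1 1 (by simp)]; exact h.adjacency
    · rw [g1 3 (by simp)]; exact h.rows
    · exact g3
    · exact g4
    · intro i hi v hv
      by_cases hik : i = k
      · subst hik
        rw [g7 v hv, hset v hv]
        simp [Shearer.Stack.push, hk, hjdef]
      · by_cases hik' : i = k + 1
        · subst hik'
          rw [hset v hv]
          simp [Shearer.Stack.push, hk, hjdef]
        · rw [g8 i hik v hv]
          simpa [Shearer.Stack.push, hk, hik, hik'] using h.set i hi v hv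
    · rw [g5]; simp [Shearer.Stack.push, hk]
    · rw [g1 9 (by simp)]; exact h.depth
    · rw [g2 0 (by simp)]; exact h.weights
    · rw [g2 1 (by simp)]; exact h.slack
    · exact g6
    · simp only [Shearer.Stack.push]; omega
    · intro i
      simp only [Shearer.Stack.push, Function.update_apply]
      split_ifs
      · exact hj.le
      · exact h.vert_le i

theorem runs_stepCode (hK : 1 ≤ K) (h : Represents n adj q α K σ m) (hnh : ¬ σ.Halted n K) :
    Runs stepCode m (200 + 40 * n)
      (Represents n adj q α K (σ.step n adj fun v => (1 + α) * q v)) := by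
  have hl := h.level
  have hlK := h.level_le
  have hguard : (Test.and (.natLe (.const 1) levelE) (.natLe (.add ptrE (.const 1)) (reg 0))).Holds m
      ↔ 1 ≤ σ.level ∧ σ.ptr σ.level < n := by
    simp [Test.Holds, NatExpr.eval, levelE, ptrE, hl, h.ptr, h.size, Nat.succ_le_iff]
  refine (Runs.ite (T := 140 + 40 * n) (fun hb => ?_) fun hb => ?_).mono
    (by simp only [Test.cost, NatExpr.cost, levelE, ptrE, cost_reg]; omega) fun _ h => h
  · rw [hguard] at hb
    rw [Shearer.Stack.step, if_pos hb]
    have hguard' : (Test.and (.natLe (.const 1) (.read 1 (cellE vertE ptrE)))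
        (.natLe (.const 1) (.read 6 (cellE levelE ptrE)))).Holds m ↔
        adj (σ.vert σ.level) (σ.ptr σ.level) ∧ σ.ptr σ.level ∈ σ.set σ.level := by
      have hv := h.vert_le σ.level
      simp only [Test.Holds, NatExpr.eval, levelE, ptrE, vertE, cellE, eval_reg, hl, h.ptr, h.vert]
      rw [h.rows _ (by omega), h.rows _ (by omega), h.adjacency _ hv _ hb.2, h.set _ hlK _ hb.2]
    refine (Runs.ite (T := 100 + 40 * n) (fun hc => ?_) fun hc => ?_).mono
      (by simp only [Test.cost, NatExpr.cost, levelE, ptrE, vertE, cellE, cost_reg]; omega)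
      fun _ h => h
    · rw [if_pos (hguard'.1 hc)]
      exact runs_pushCode h hb.1 hb.2
    · rw [if_neg fun e => hc (hguard'.2 e)]
      exact (runs_nextCode h).mono (by omega) fun _ h => h
  · rw [hguard] at hb
    rw [Shearer.Stack.step, if_neg hb]
    -- A pop at level K never happens: there the failed guard means that the pointer has reached n,
    -- and the stack has halted.
    refine (runs_popCode h (lt_of_le_of_ne hlK fun e => ?_)).mono (by omega) fun _ h => h
    have : ¬ (n ≤ σ.ptr σ.level) := fun e' => hnh ⟨e.ge, e'⟩
    exact hb ⟨by omega, by omega⟩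

/-- Evaluate until the root is complete. -/
def evalCode : Program :=
  .while (.not (.and (.natLe (reg 9) levelE) (.natLe (reg 0) ptrE))) stepCode

theorem runs_evalCode (hK : 1 ≤ K) {N : ℕ} {σ' : Shearer.Stack}
    (hr : Shearer.Stack.Reach n adj (fun v => (1 + α) * q v) K N σ σ') (hh : σ'.Halted n K)
    (h : Represents n adj q α K σ m) :
    Runs evalCode m (N * (240 + 40 * n) + 40) (Represents n adj q α K σ') := by
  have hguard : ∀ {σ m}, Represents n adj q α K σ m →
      ((Test.not (.and (.natLe (reg 9) levelE) (.natLe (reg 0) ptrE))).Holds m ↔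
        ¬ σ.Halted n K) := by
    intro σ m h
    simp [Test.Holds, NatExpr.eval, levelE, ptrE, h.level, h.ptr, h.size, h.depth,
      Shearer.Stack.Halted]
  induction hr generalizing m with
  | refl N σ =>
    refine ⟨_, m, .whileFalse fun hb => (hguard h).1 hb hh, ?_, h⟩
    simp only [Test.cost, NatExpr.cost, levelE, ptrE, cost_reg]
    omega
  | head h0 _ ih =>
    obtain ⟨t, m', he, ht, hm'⟩ := runs_stepCode hK h h0
    obtain ⟨t', m'', he', ht', hm''⟩ := ih hh hm'
    refine ⟨_, m'', .whileTrue ((hguard h).2 h0) he he', ?_, hm''⟩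
    simp only [Test.cost, NatExpr.cost, levelE, ptrE, cost_reg]
    rw [add_mul]
    omega

end

end RealRAM

namespace RealRAM

/-! ### The whole program -/

/-- The memories agree outside of the natural arrays in `A` and the real arrays in `B`. -/
def AgreeOff (A B : List ℕ) (m m' : Memory) : Prop :=
  (∀ a, a ∉ A → m'.nat a = m.nat a) ∧ ∀ a, a ∉ B → m'.real a = m.real a

theorem AgreeOff.refl (A B : List ℕ) (m : Memory) : AgreeOff A B m m :=
  ⟨fun _ _ => rfl, fun _ _ => rfl⟩

theorem AgreeOff.trans {A B A' B' : List ℕ} {m m' m'' : Memory} (h : AgreeOff A B m m')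
    (h' : AgreeOff A' B' m' m'') : AgreeOff (A ++ A') (B ++ B') m m'' := by
  constructor <;> intro a ha <;> rw [List.mem_append, not_or] at ha
  · exact (h'.1 a ha.2).trans (h.1 a ha.1)
  · exact (h'.2 a ha.2).trans (h.2 a ha.1)

theorem AgreeOff.setNat {A B : List ℕ} {m m' : Memory} (h : AgreeOff A B m m') {a : ℕ} (ha : a ∈ A)
    (i k : ℕ) : AgreeOff A B m (m'.setNat a i k) := by
  refine ⟨fun b hb => ?_, h.2⟩
  rw [← h.1 b hb]
  exact Function.update_of_ne (fun e => hb (by rwa [e])) _ _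

theorem AgreeOff.setReal {A B : List ℕ} {m m' : Memory} (h : AgreeOff A B m m') {a : ℕ}
    (ha : a ∈ B) (i : ℕ) (x : ℝ) : AgreeOff A B m (m'.setReal a i x) := by
  refine ⟨h.1, fun b hb => ?_⟩
  rw [← h.2 b hb]
  exact Function.update_of_ne (fun e => hb (by rwa [e])) _ _

/-- Compute the real number `4 n`. -/
def sizeCode : Program :=
  forLoop 8 (reg 0) (.setReal 3 (.const 0) (.add (realReg 3) (.const 4)))

theorem runs_sizeCode {n : ℕ} {m : Memory} (hn : m.nat 0 0 = n) (h0 : m.real 3 0 = 0) :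
    Runs sizeCode m (30 * n + 30)
      fun m' => AgreeOff [8] [3] m m' ∧ m'.real 3 0 = 4 * n := by
  refine (Runs.forLoop (T := 6) (fun i m' => AgreeOff [8] [3] m m' ∧ m'.real 3 0 = 4 * i) n
    ⟨(AgreeOff.refl _ _ m).setNat (by simp) _ _, by simpa [Memory.setNat] using h0⟩ ?_ ?_).mono ?_
    fun _ h => h
  · rintro i m' ⟨h, -⟩
    simpa [h.1 0 (by simp)] using hn
  · rintro i hi m' ⟨h, h3⟩ hc
    refine (Runs.setReal ⟨hc, (h.setReal (by simp) _ _).setNat (by simp) _ _, ?_⟩)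
    simp [Memory.setNat, Memory.setReal, NatExpr.eval, RealExpr.eval, h3]
    ring
  · simp only [cost_reg]
    omega

/-- Search for the least `s ≥ 1` with `4 n ≤ s² α`. -/
def rootCode : Program :=
  .seq (.setNat 10 (.const 0) (.const 1)) <|
  .seq (.setReal 4 (.const 0) (.const 1)) <|
  .while (.not (.realLe (realReg 3) (.mul (.mul (realReg 4) (realReg 4)) (realReg 1)))) <|
  .seq (.setReal 4 (.const 0) (.add (realReg 4) (.const 1)))
    (.setNat 10 (.const 0) (.add (reg 10) (.const 1)))

/-- Linear search replaces a square root. The counter is kept both as a natural and as a real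
number, since the machine cannot convert; N rounds yield s = N + 1. -/
theorem runs_rootCode {α y : ℝ} {N : ℕ} {m : Memory} (hα : m.real 1 0 = α) (hy : m.real 3 0 = y)
    (hN : y ≤ (N + 1 : ℕ) * (N + 1 : ℕ) * α) (hN' : ∀ i < N, ¬ y ≤ (i + 1 : ℕ) * (i + 1 : ℕ) * α) :
    Runs rootCode m (30 * N + 30)
      fun m' => AgreeOff [10] [4] m m' ∧ m'.nat 10 0 = N + 1 := by
  have hg : ∀ (i : ℕ) (m' : Memory), AgreeOff [10] [4] m m' → m'.real 4 0 = (i + 1 : ℕ) →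
      ((Test.not (.realLe (realReg 3)
        (.mul (.mul (realReg 4) (realReg 4)) (realReg 1)))).Holds m' ↔
        ¬ y ≤ (i + 1 : ℕ) * (i + 1 : ℕ) * α) := by
    intro i m' h h4
    simp only [Test.Holds, RealExpr.eval, eval_realReg, h.2 3 (by simp), h.2 1 (by simp), h4, hα, hy]
  refine (Runs.seq <| Runs.setNat <| Runs.seq <| Runs.setReal <| Runs.while_count (T := 12)
    (fun i m' => AgreeOff [10] [4] m m' ∧ m'.nat 10 0 = i + 1 ∧ m'.real 4 0 = (i + 1 : ℕ)) N
    ?_ ?_ ?_).mono ?_ fun m' h => ⟨h.1, h.2.1⟩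
  · rintro i hi m' ⟨h, h10, h4⟩
    refine ⟨(hg i m' h h4).2 (hN' i hi), (Runs.seq (Runs.setReal (Runs.setNat
      ⟨(h.setReal (by simp) _ _).setNat (by simp) _ _, ?_, ?_⟩))).mono ?_ fun _ h => h⟩
    · simp [NatExpr.cost, RealExpr.cost]
    · simp [Memory.setNat, Memory.setReal, NatExpr.eval, h10]
    · simp [Memory.setNat, Memory.setReal, NatExpr.eval, RealExpr.eval, h4]
  · rintro m' ⟨h, -, h4⟩
    rw [hg N m' h h4]
    exact not_not.2 hN
  · refine ⟨((AgreeOff.refl _ _ m).setNat (by simp) _ _).setReal (by simp) _ _, ?_, ?_⟩ <;>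
      simp [Memory.setNat, Memory.setReal, NatExpr.eval, RealExpr.eval]
  · simp only [NatExpr.cost, RealExpr.cost, Test.cost, cost_realReg]
    omega

/-- Search for the least `L` with `4 n ≤ 2 ^ L α`. -/
def logCode : Program :=
  .seq (.setNat 11 (.const 0) (.const 0)) <|
  .seq (.setReal 5 (.const 0) (.const 1)) <|
  .while (.not (.realLe (realReg 3) (.mul (realReg 5) (realReg 1)))) <|
  .seq (.setReal 5 (.const 0) (.mul (realReg 5) (.const 2)))
    (.setNat 11 (.const 0) (.add (reg 11) (.const 1)))

theorem runs_logCode {α y : ℝ} {N : ℕ} {m : Memory} (hα : m.real 1 0 = α) (hy : m.real 3 0 = y)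
    (hN : y ≤ 2 ^ N * α) (hN' : ∀ i < N, ¬ y ≤ 2 ^ i * α) :
    Runs logCode m (30 * N + 30)
      fun m' => AgreeOff [11] [5] m m' ∧ m'.nat 11 0 = N := by
  have hg : ∀ (i : ℕ) (m' : Memory), AgreeOff [11] [5] m m' → m'.real 5 0 = 2 ^ i →
      ((Test.not (.realLe (realReg 3) (.mul (realReg 5) (realReg 1)))).Holds m' ↔
        ¬ y ≤ 2 ^ i * α) := by
    intro i m' h h4
    simp only [Test.Holds, RealExpr.eval, eval_realReg, h.2 3 (by simp), h.2 1 (by simp), h4, hα, hy]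
  refine (Runs.seq <| Runs.setNat <| Runs.seq <| Runs.setReal <| Runs.while_count (T := 12)
    (fun i m' => AgreeOff [11] [5] m m' ∧ m'.nat 11 0 = i ∧ m'.real 5 0 = 2 ^ i) N
    ?_ ?_ ?_).mono ?_ fun m' h => ⟨h.1, h.2.1⟩
  · rintro i hi m' ⟨h, h10, h4⟩
    refine ⟨(hg i m' h h4).2 (hN' i hi), (Runs.seq (Runs.setReal (Runs.setNat
      ⟨(h.setReal (by simp) _ _).setNat (by simp) _ _, ?_, ?_⟩))).mono ?_ fun _ h => h⟩
    · simp [NatExpr.cost, RealExpr.cost]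
    · simp [Memory.setNat, Memory.setReal, NatExpr.eval, h10]
    · simp [Memory.setNat, Memory.setReal, NatExpr.eval, RealExpr.eval, h4, pow_succ]
  · rintro m' ⟨h, -, h4⟩
    rw [hg N m' h h4]
    exact not_not.2 hN
  · refine ⟨((AgreeOff.refl _ _ m).setNat (by simp) _ _).setReal (by simp) _ _, ?_, ?_⟩ <;>
      simp [Memory.setNat, Memory.setReal, NatExpr.eval, RealExpr.eval]
  · simp only [NatExpr.cost, RealExpr.cost, Test.cost, cost_realReg]
    omega

/-- Compute the index `4 s L + 1` of the root frame. -/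
def depthCode : Program :=
  .seq (.setNat 9 (.const 0) (.const 1)) <|
  forLoop 8 (reg 11) (.setNat 9 (.const 0)
    (.add (reg 9) (.add (.add (reg 10) (reg 10)) (.add (reg 10) (reg 10)))))

/-- The product is formed by repeated addition; the extra 1 is the level of the virtual root. -/
theorem runs_depthCode {s N : ℕ} {m : Memory} (hs : m.nat 10 0 = s) (hN : m.nat 11 0 = N) :
    Runs depthCode m (40 * N + 40)
      fun m' => AgreeOff [8, 9] [] m m' ∧ m'.nat 9 0 = 4 * s * N + 1 := by
  refine (Runs.seq <| Runs.setNat <| Runs.forLoop (T := 16)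
    (fun i m' => AgreeOff [8, 9] [] m m' ∧ m'.nat 9 0 = 4 * s * i + 1) N
    ⟨((AgreeOff.refl _ _ m).setNat (by simp) _ _).setNat (by simp) _ _, ?_⟩ ?_ ?_).mono ?_
    fun _ h => h
  · simp [Memory.setNat, NatExpr.eval]
  · rintro i m' ⟨h, -⟩
    simpa [h.1 11 (by simp)] using hN
  · rintro i hi m' ⟨h, h3⟩ hc
    refine (Runs.setNat ⟨?_, (h.setNat (by simp) _ _).setNat (by simp) _ _, ?_⟩)
    · simpa [Memory.setNat, NatExpr.eval] using hc
    · simp [Memory.setNat, NatExpr.eval, h3, h.1 10 (by simp), hs]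
      ring
  · simp only [cost_reg, NatExpr.cost]
    omega

/-- Compute the multiples of `n`. -/
def rowsCode : Program :=
  forLoop 8 (.add (reg 0) (reg 9))
    (.setNat 3 (.add (reg 8) (.const 1)) (.add (.read 3 (reg 8)) (reg 0)))

/-- Naturals cannot be multiplied, so row offsets are tabulated. The range n + K covers the rows of
vertices, up to n, and those of frames, up to K. -/
theorem runs_rowsCode {n K : ℕ} {m : Memory} (hn : m.nat 0 0 = n) (hK : m.nat 9 0 = K)
    (h0 : m.nat 3 0 = 0) :
    Runs rowsCode m (40 * (n + K) + 40)
      fun m' => AgreeOff [3, 8] [] m m' ∧ ∀ i ≤ n + K, m'.nat 3 i = i * n := by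
  refine (Runs.forLoop (T := 11)
    (fun j m' => AgreeOff [3, 8] [] m m' ∧ ∀ i ≤ j, m'.nat 3 i = i * n) (n + K)
    ⟨(AgreeOff.refl _ _ m).setNat (by simp) _ _, ?_⟩ ?_ ?_).mono ?_ fun _ h => h
  · intro i hi
    obtain rfl := Nat.le_zero.1 hi
    simpa [Memory.setNat, NatExpr.eval] using h0
  · rintro i m' ⟨h, -⟩
    simp [NatExpr.eval, h.1 0 (by simp), h.1 9 (by simp), hn, hK]
  · rintro i hi m' ⟨h, h3⟩ hc
    refine (Runs.setNat ⟨?_, (h.setNat (by simp) _ _).setNat (by simp) _ _, fun j hj => ?_⟩)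
    · simpa [Memory.setNat, NatExpr.eval] using hc
    · by_cases hji : j = i + 1
      · subst hji
        simp [Memory.setNat, NatExpr.eval, hc, h3, h.1 0 (by simp), hn]
        ring
      · have := h3 j (by omega)
        simpa [Memory.setNat, NatExpr.eval, hc, hji] using this
  · simp only [cost_reg, NatExpr.cost]
    omega

/-- Enter the virtual root vertex `n` and its set of children. -/
def childrenCode : Program :=
  forLoop 8 (reg 0) (.seq (.setNat 1 (cellE (reg 0) (reg 8)) (.const 1))
    (.setNat 6 (cellE (reg 9) (reg 8)) (.const 1)))

/-- The row of the root starts at n * n, just behind the input matrix, which therefore stays intact.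
-/
theorem runs_childrenCode {n K : ℕ} {m : Memory} (hn : m.nat 0 0 = n) (hK : m.nat 9 0 = K)
    (hrows : ∀ i ≤ n + K, m.nat 3 i = i * n) :
    Runs childrenCode m (40 * n + 40)
      fun m' => AgreeOff [1, 6, 8] [] m m' ∧ (∀ e < n * n, m'.nat 1 e = m.nat 1 e) ∧
        (∀ v < n, m'.nat 1 (n * n + v) = 1) ∧ ∀ v < n, m'.nat 6 (K * n + v) = 1 := by
  refine (Runs.forLoop (T := 20)
    (fun j m' => AgreeOff [1, 6, 8] [] m m' ∧ (∀ e < n * n, m'.nat 1 e = m.nat 1 e) ∧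
        (∀ v < j, m'.nat 1 (n * n + v) = 1) ∧ ∀ v < j, m'.nat 6 (K * n + v) = 1) n
    ⟨(AgreeOff.refl _ _ m).setNat (by simp) _ _, ?_, by simp, by simp⟩ ?_ ?_).mono ?_ fun _ h => h
  · intro i hi
    simp [Memory.setNat]
  · rintro i m' ⟨h, -⟩
    simp [h.1 0 (by simp), hn]
  · rintro i hi m' ⟨h, h1, h2, h3⟩ hc
    have e1 : (cellE (reg 0) (reg 8)).eval m' = n * n + i := by
      simp [cellE, NatExpr.eval, hc, h.1 0 (by simp), h.1 3 (by simp), hn, hrows n]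
    have e2 : (cellE (reg 9) (reg 8)).eval (m'.setNat 1 (n * n + i) 1) = K * n + i := by
      simp [cellE, NatExpr.eval, Memory.setNat, hc, h.1 9 (by simp), h.1 3 (by simp), hK, hrows K]
    refine (Runs.seq (Runs.setNat (Runs.setNat ?_))).mono
      (by simp [NatExpr.cost, cellE]) fun _ h => h
    rw [e1]
    simp only [NatExpr.eval]
    rw [e2]
    refine ⟨by simpa [Memory.setNat] using hc, ((h.setNat (by simp) _ _).setNat (by simp) _ _).setNat
      (by simp) _ _, fun e he => ?_, fun v hv => ?_, fun v hv => ?_⟩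
    · have hne : e ≠ n * n + i := by omega
      simpa [Memory.setNat, hne] using h1 e he
    · by_cases hvi : v = i
      · simp [Memory.setNat, hvi]
      · simpa [Memory.setNat, hvi] using h2 v (by omega)
    · by_cases hvi : v = i
      · simp [Memory.setNat, hvi]
      · simpa [Memory.setNat, hvi] using h3 v (by omega)
  · simp only [cost_reg]
    omega

/-- Initialize the root frame. -/
def frameCode : Program :=
  .seq (.setNat 7 (.const 0) (reg 9)) <|
  .seq (.setNat 4 (reg 9) (reg 0)) (.setReal 2 (reg 9) (.const 1))

/-- Answer `1` if the result of the evaluation is positive, `0` otherwise. -/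
def answerCode : Program :=
  .ite (.realLe (.read 2 (reg 9)) (.const 0)) (.setNat 2 (.const 0) (.const 0))
    (.setNat 2 (.const 0) (.const 1))

/-- The algorithm. -/
def shearerCode : Program :=
  .seq sizeCode <| .seq rootCode <| .seq logCode <| .seq depthCode <| .seq rowsCode <|
  .seq childrenCode <| .seq frameCode <| .seq evalCode answerCode

theorem runs_answerCode {n : ℕ} {adj : ℕ → ℕ → Prop} {q : ℕ → ℝ} {α : ℝ} {K : ℕ}
    {σ : Shearer.Stack} {m : Memory} (h : Represents n adj q α K σ m) :
    Runs answerCode m 20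
      fun m' => (m'.output = 1 ∧ 0 < σ.prod K) ∨ (m'.output = 0 ∧ ¬ 0 < σ.prod K) := by
  refine (Runs.ite (T := 4) (fun hb => ?_) fun hb => ?_).mono
    (by simp [Test.cost, RealExpr.cost]) fun _ h => h <;>
  · refine (Runs.setNat ?_).mono (by simp [NatExpr.cost]) fun _ h => h
    simp only [Test.Holds, RealExpr.eval, eval_reg, h.depth, h.prod, Rat.cast_zero] at hb
    simpa [Memory.output, Memory.setNat, NatExpr.eval] using hb

theorem runs_frameCode {n : ℕ} {adj : ℕ → ℕ → Prop} {q : ℕ → ℝ} {α : ℝ} {K : ℕ} {m : Memory}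
    (hn : m.nat 0 0 = n) (hadj : ∀ a ≤ n, ∀ b < n, 1 ≤ m.nat 1 (a * n + b) ↔ adj a b)
    (hrows : ∀ i ≤ n + K, m.nat 3 i = i * n) (hK : m.nat 9 0 = K) (hq : m.real 0 = q)
    (hα : m.real 1 0 = α) (hvert : ∀ i, m.nat 4 i = 0) (hptr : ∀ i, m.nat 5 i = 0)
    (hset : ∀ v < n, m.nat 6 (K * n + v) = 1) :
    Runs frameCode m 30 fun m' => ∃ σ, Represents n adj q α K σ m' ∧ σ.level = K ∧ σ.vert K = n ∧
      σ.ptr K = 0 ∧ σ.set K = Finset.range n ∧ σ.prod K = 1 := by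
  refine (Runs.seq <| Runs.setNat <| Runs.seq <| Runs.setNat <| Runs.setReal ?_).mono
    (by simp [NatExpr.cost, RealExpr.cost]) fun _ h => h
  -- The stack is read off the memory; cells that were never written are 0, which is a valid pointer
  -- and a harmless vertex.
  refine ⟨⟨K, Function.update (m.nat 4) K n, m.nat 5,
    fun i => (Finset.range n).filter fun v => 1 ≤ m.nat 6 (i * n + v),
    Function.update (m.real 2) K 1⟩, ?_, rfl, by simp, hptr K, ?_, by simp⟩
  · constructor <;>
      simp [Memory.setNat, Memory.setReal, NatExpr.eval, RealExpr.eval, hn, hK, hq, hα]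
    · simpa using hadj
    · exact hrows
    · exact fun i _ v hv => fun _ => hv
    · intro i
      rw [Function.update_apply]
      split_ifs
      · exact le_rfl
      · rw [hvert i]; exact Nat.zero_le _
  · exact Finset.filter_true_of_mem fun v hv => (hset v (Finset.mem_range.1 hv)).ge

theorem runs_shearerCode {n d s L : ℕ} (G : SimpleGraph (Fin n)) (p : Fin n → ℝ) {α : ℝ}
    (hd : ∀ a < n, ∀ S, (Shearer.nbr (Shearer.rootedAdj G) a S).card ≤ d)
    (hs : 4 * (n : ℝ) ≤ (s + 1 : ℕ) * (s + 1 : ℕ) * α)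
    (hs' : ∀ i < s, ¬ 4 * (n : ℝ) ≤ (i + 1 : ℕ) * (i + 1 : ℕ) * α)
    (hL : 4 * (n : ℝ) ≤ 2 ^ L * α) (hL' : ∀ i < L, ¬ 4 * (n : ℝ) ≤ 2 ^ i * α) {h : ℕ}
    (hh : h = 4 * (s + 1) * L) :
    Runs shearerCode (inputMemory G p α)
      ((n + n * Shearer.Stack.frameSteps n d h) * (240 + 40 * n) +
        (110 * n + 30 * s + 70 * L + 40 * h + 400))
      fun m' =>
        (m'.output = 1 ∧ 0 < ∏ a : Fin n, Shearer.clip (((1 + α) • p) a)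
          (Shearer.truncProd G.Adj ((1 + α) • p) h a (Finset.univ.filter (a < ·)))) ∨
        (m'.output = 0 ∧ ¬ 0 < ∏ a : Fin n, Shearer.clip (((1 + α) • p) a)
          (Shearer.truncProd G.Adj ((1 + α) • p) h a (Finset.univ.filter (a < ·)))) := by
  set m := inputMemory G p α with hm
  have m0 : m.nat 0 0 = n := by simp [hm, inputMemory]
  have hz : ∀ a, a ≠ 0 → a ≠ 1 → ∀ i, m.nat a i = 0 := fun a h0 h1 i => by
    simp [hm, inputMemory, h0, h1]
  have hα : m.real 1 0 = α := by simp [hm, inputMemory]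
  have hr3 : m.real 3 0 = 0 := by simp [hm, inputMemory]
  have hadj0 : ∀ a < n, ∀ b < n, 1 ≤ m.nat 1 (a * n + b) ↔ Shearer.rootedAdj G a b := by
    intro a ha b hb
    have e : (∃ i j : Fin n, a * n + b = i * n + j ∧ G.Adj i j) ↔ G.Adj ⟨a, ha⟩ ⟨b, hb⟩ := by
      constructor
      · rintro ⟨i, j, he, h⟩
        obtain ⟨rfl, rfl⟩ := row_add_inj hb j.2 he
        exact h
      · exact fun h => ⟨_, _, rfl, h⟩
    rw [← Shearer.rootedAdj_coe G ⟨a, ha⟩ ⟨b, hb⟩] at e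
    rw [← e]
    simp only [hm, inputMemory]
    split_ifs with h1 h2 <;> simp_all
  have hq : ∀ v : Fin n, (1 + α) * m.real 0 v = ((1 + α) • p) v := fun v => by
    simp [hm, inputMemory]
  clear_value m
  clear hm
  refine (Runs.seq <| (runs_sizeCode m0 hr3).mono le_rfl ?_).mono
    (T := (30 * n + 30) + ((30 * s + 30) + ((30 * L + 30) + ((40 * L + 40) +
      ((40 * (n + (h + 1)) + 40) + ((40 * n + 40) + (30 +
        (((n + n * Shearer.Stack.frameSteps n d h) * (240 + 40 * n) + 40) + 20)))))))) (by omega)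
    fun _ h => h
  rintro m1 ⟨a1, f1⟩
  refine Runs.seq <| (runs_rootCode ((congrFun (a1.2 1 (by simp)) 0).trans hα) f1 hs hs').mono
    le_rfl ?_
  rintro m2 ⟨a2, f2⟩
  have b2 := a1.trans a2
  refine Runs.seq <| (runs_logCode ((congrFun (b2.2 1 (by simp)) 0).trans hα)
    ((congrFun (a2.2 3 (by simp)) 0).trans f1) hL hL').mono le_rfl ?_
  rintro m3 ⟨a3, f3⟩
  have b3 := b2.trans a3
  refine Runs.seq <| (runs_depthCode ((congrFun (a3.1 10 (by simp)) 0).trans f2) f3).mono le_rfl ?_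
  rintro m4 ⟨a4, f4⟩
  have b4 := b3.trans a4
  rw [← hh] at f4
  refine Runs.seq <| (runs_rowsCode ((congrFun (b4.1 0 (by simp)) 0).trans m0) f4
    ((congrFun (b4.1 3 (by simp)) 0).trans (hz 3 (by simp) (by simp) 0))).mono le_rfl ?_
  rintro m5 ⟨a5, f5⟩
  have b5 := b4.trans a5
  have k5 := (congrFun (a5.1 9 (by simp)) 0).trans f4
  refine Runs.seq <| (runs_childrenCode ((congrFun (b5.1 0 (by simp)) 0).trans m0) k5 f5).mono
    le_rfl ?_
  rintro m6 ⟨a6, f6, g6, h6⟩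
  have b6 := b5.trans a6
  refine Runs.seq <| (runs_frameCode (adj := Shearer.rootedAdj G)
    ((congrFun (b6.1 0 (by simp)) 0).trans m0) ?_
    (fun i hi => (congrFun (a6.1 3 (by simp)) i).trans (f5 i hi))
    ((congrFun (a6.1 9 (by simp)) 0).trans k5) (b6.2 0 (by simp))
    ((congrFun (b6.2 1 (by simp)) 0).trans hα)
    (fun i => (congrFun (b6.1 4 (by simp)) i).trans (hz 4 (by simp) (by simp) i))
    (fun i => (congrFun (b6.1 5 (by simp)) i).trans (hz 5 (by simp) (by simp) i)) h6).mono
    le_rfl ?_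
  · intro a ha b hb
    rcases ha.lt_or_eq with ha | rfl
    · have he : a * n + b < n * n :=
        calc a * n + b < a * n + n := by omega
          _ = (a + 1) * n := by ring
          _ ≤ n * n := Nat.mul_le_mul_right _ ha
      rw [f6 _ he, b5.1 1 (by simp)]
      exact hadj0 a ha b hb
    · rw [g6 b hb]
      exact ⟨fun _ => Or.inl ⟨rfl, hb⟩, fun _ => le_rfl⟩
  rintro m7 ⟨σ, hσ, s1, s2, s3, s4, s5⟩
  obtain ⟨τ, hr, hhalt, hprod⟩ := Shearer.Stack.reach_root (x := fun v => (1 + α) * m.real 0 v)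
    (fun _ _ => Shearer.rootedAdj.lt) hd subset_rfl s1 s2 s3 s4 s5
  refine Runs.seq <| (runs_evalCode (by omega) hr hhalt hσ).mono le_rfl ?_
  intro m8 hm8
  refine (runs_answerCode hm8).mono le_rfl ?_
  rw [hprod, Shearer.truncProd_root G hq]
  exact fun _ h => h

end RealRAM

namespace Shearer

/-! ### The running time -/

theorem two_thirds_le_log_two : (2 / 3 : ℝ) ≤ Real.log 2 := by
  have := Real.log_two_gt_d9
  linarith

/-- By minimality the candidate s itself fails, so s² α < 4n ≤ 4xα. -/
theorem root_index_le {n s : ℕ} {α x : ℝ} (hα : 0 < α) (hx2 : 2 ≤ x) (hnx : (n : ℝ) ≤ x * α)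
    (hs : ∀ i < s, ¬ 4 * (n : ℝ) ≤ (i + 1 : ℕ) * (i + 1 : ℕ) * α) :
    (s : ℝ) ≤ 2 * √x := by
  rcases Nat.eq_zero_or_pos s with rfl | h
  · simp
  have h1 := hs (s - 1) (by omega)
  rw [Nat.sub_add_cancel h, not_le] at h1
  have h2 : (s : ℝ) * s < 4 * x := by
    refine lt_of_mul_lt_mul_right ?_ hα.le
    linarith
  refine abs_le_of_sq_le_sq' ?_ (by positivity) |>.2
  rw [mul_pow, Real.sq_sqrt (by linarith)]
  nlinarith

/-- Minimality gives 2^(L-1) < 4x, so L ≤ 3 + log x / log 2; since log x ≥ log 2 ≥ 2/3, this is at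
most (9/2 + 3/2) log x. -/
theorem log_index_le {n L : ℕ} {α x : ℝ} (hα : 0 < α) (hx2 : 2 ≤ x) (hnx : (n : ℝ) ≤ x * α)
    (hL : ∀ i < L, ¬ 4 * (n : ℝ) ≤ 2 ^ i * α) : (L : ℝ) ≤ 6 * Real.log x := by
  have hl2 := two_thirds_le_log_two
  have hlx : Real.log 2 ≤ Real.log x := Real.log_le_log (by norm_num) hx2
  rcases Nat.eq_zero_or_pos L with rfl | h
  · simp only [Nat.cast_zero]
    linarith
  obtain ⟨k, rfl⟩ := Nat.exists_eq_add_of_le' h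
  have h1 := hL k (by omega)
  rw [not_le] at h1
  have h2 : (2 : ℝ) ^ k < 2 ^ 2 * x := by
    refine lt_of_mul_lt_mul_right ?_ hα.le
    linarith
  have h3 := Real.log_le_log (by positivity) h2.le
  rw [Real.log_pow, Real.log_mul (by positivity) (by linarith), Real.log_pow] at h3
  push_cast at h3 ⊢
  by_contra hc
  rw [not_le] at hc
  nlinarith

theorem time_le_exp {n d s L h : ℕ} {x : ℝ} (hx2 : 2 ≤ x) (hnx : (n : ℝ) ≤ x) (hd2 : 2 ≤ d)
    (hdx : (d : ℝ) ≤ x) (hs : (s : ℝ) ≤ 2 * √x) (hL : (L : ℝ) ≤ 6 * Real.log x)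
    (hh : h = 4 * (s + 1) * L) :
    (((n + n * Stack.frameSteps n d h) * (240 + 40 * n) +
        (110 * n + 30 * s + 70 * L + 40 * h + 400) : ℕ) : ℝ) ≤
      Real.exp (100 * (√x * Real.log x * Real.log d)) := by
  have hl2 := two_thirds_le_log_two
  have hlx : Real.log 2 ≤ Real.log x := Real.log_le_log (by norm_num) hx2
  have hd2' : (2 : ℝ) ≤ d := by exact_mod_cast hd2
  have hld : Real.log 2 ≤ Real.log d := Real.log_le_log (by norm_num) hd2'
  have hldx : Real.log d ≤ Real.log x := Real.log_le_log (by linarith) hdx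
  have hsx : 1 ≤ √x := by rw [Real.one_le_sqrt]; linarith
  have hsx' : √x ≤ x := by
    rw [Real.sqrt_le_left (by linarith)]
    nlinarith
  have hlx' : Real.log x ≤ x := (Real.log_le_sub_one_of_pos (by linarith)).trans (by linarith)
  set ℓ := Real.log x with hℓ
  set Λ := √x * ℓ * Real.log d with hΛ
  -- As x and d are at least 2, both logarithms are at least 2/3; hence log x and all constants are
  -- absorbed into multiples of Λ.
  have hℓΛ : ℓ ≤ 3 / 2 * Λ := by
    have h1 : ℓ ≤ √x * ℓ := le_mul_of_one_le_left (by linarith) hsx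
    have h2 : √x * ℓ * (2 / 3) ≤ Λ := mul_le_mul_of_nonneg_left (by linarith) (by linarith)
    linarith
  have hΛ0 : 4 / 9 ≤ Λ := by linarith
  -- 72 = 12 · 6, from 4(s+1) ≤ 12√x and L ≤ 6 log x.
  have hh' : (h : ℝ) ≤ 72 * (√x * ℓ) := by
    rw [hh]
    push_cast
    have h1 : 4 * ((s : ℝ) + 1) ≤ 12 * √x := by linarith
    have h2 := mul_le_mul h1 hL (Nat.cast_nonneg _) (by positivity)
    linarith
  have hexp : x = Real.exp ℓ := (Real.exp_log (by linarith)).symm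
  have hexp1 : (2.7 : ℝ) ≤ Real.exp 1 := by
    have := Real.exp_one_gt_d9
    linarith
  have hpow : ∀ k : ℕ, (2.7 : ℝ) ^ k ≤ Real.exp k := fun k => by
    rw [← mul_one (k : ℝ), Real.exp_nat_mul]
    gcongr
  have hF : (((n + n * Stack.frameSteps n d h) * (240 + 40 * n) : ℕ) : ℝ) ≤
      Real.exp (93 * Λ) := by
    have h1 := Stack.frameSteps_add_le (n := n) hd2 h
    have h2 : n + n * Stack.frameSteps n d h ≤ n * ((n + 1) * d ^ (h + 1)) := by
      calc n + n * Stack.frameSteps n d h = n * (Stack.frameSteps n d h + 1) := by ring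
        _ ≤ _ := Nat.mul_le_mul_left _ (by omega)
    have h3 : (((n + n * Stack.frameSteps n d h) * (240 + 40 * n) : ℕ) : ℝ) ≤
        ((n * ((n + 1) * d ^ (h + 1)) * (240 + 40 * n) : ℕ) : ℝ) := by
      exact_mod_cast Nat.mul_le_mul_right _ h2
    refine h3.trans ?_
    push_cast
    have hn0 : (0 : ℝ) ≤ n := Nat.cast_nonneg n
    have h4 : (n : ℝ) * (n + 1) * (240 + 40 * n) ≤ 320 * x ^ 3 := by
      calc (n : ℝ) * (n + 1) * (240 + 40 * n) ≤ x * (2 * x) * (160 * x) := by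
            gcongr <;> linarith
        _ = 320 * x ^ 3 := by ring
    have h5 : (d : ℝ) ^ (h + 1) ≤ Real.exp (72 * Λ + ℓ) := by
      rw [← Real.exp_log (show (0 : ℝ) < d by linarith), ← Real.exp_nat_mul]
      refine Real.exp_le_exp.2 ?_
      push_cast
      have := mul_le_mul_of_nonneg_right hh' (show 0 ≤ Real.log d by linarith)
      linarith
    calc (n : ℝ) * ((n + 1) * d ^ (h + 1)) * (240 + 40 * n)
        = n * (n + 1) * (240 + 40 * n) * d ^ (h + 1) := by ring
      _ ≤ 320 * x ^ 3 * Real.exp (72 * Λ + ℓ) :=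
          mul_le_mul h4 h5 (by positivity) (by positivity)
      _ ≤ Real.exp 6 * Real.exp ℓ ^ 3 * Real.exp (72 * Λ + ℓ) := by
          rw [← hexp]
          have := hpow 6
          gcongr
          norm_num at this
          linarith
      _ = Real.exp (6 + 3 * ℓ + (72 * Λ + ℓ)) := by
          rw [← Real.exp_nat_mul, ← Real.exp_add, ← Real.exp_add]
          norm_num
      -- Λ ≥ 4/9 gives 6 ≤ 13.5 Λ, and 4ℓ ≤ 6Λ, so the exponent is at most 91.5 Λ.
      _ ≤ Real.exp (93 * Λ) := Real.exp_le_exp.2 (by linarith)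
  have hR : ((110 * n + 30 * s + 70 * L + 40 * h + 400 : ℕ) : ℝ) ≤ Real.exp (93 * Λ) := by
    push_cast
    have h1 : (h : ℝ) ≤ 72 * x ^ 2 := by
      refine hh'.trans ?_
      have := mul_le_mul hsx' hlx' (by linarith) (by linarith)
      nlinarith
    calc (110 * n + 30 * s + 70 * L + 40 * h + 400 : ℝ) ≤ 3300 * x ^ 2 := by nlinarith
      _ ≤ Real.exp 9 * Real.exp ℓ ^ 2 := by
          rw [← hexp]
          have := hpow 9
          gcongr
          norm_num at this
          linarith
      _ = Real.exp (9 + 2 * ℓ) := by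
          rw [← Real.exp_nat_mul, ← Real.exp_add]
          norm_num
      _ ≤ Real.exp (93 * Λ) := Real.exp_le_exp.2 (by linarith)
  rw [Nat.cast_add]
  calc _ ≤ 2 * Real.exp (93 * Λ) := by linarith
    _ ≤ Real.exp 1 * Real.exp (93 * Λ) := by
        gcongr
        linarith
    _ = Real.exp (1 + 93 * Λ) := (Real.exp_add _ _).symm
    _ ≤ Real.exp (100 * Λ) := Real.exp_le_exp.2 (by linarith)

theorem exists_least {P : ℕ → Prop} (h : ∃ i, P i) : ∃ i, P i ∧ ∀ j < i, ¬ P j := by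
  classical exact ⟨Nat.find h, Nat.find_spec h, fun _ hj => Nat.find_min h hj⟩

end Shearer

theorem mainTheorem4 :
    ∃ (P : RealRAM.Program) (C : ℝ),
      ∀ (n : ℕ) (G : SimpleGraph (Fin n)) [DecidableRel G.Adj] (p : Fin n → ℝ) (α : ℝ),
        (∀ v, 0 < p v ∧ p v < 1) → 0 < α → α < 1 →
        ∃ (t : ℕ) (m : RealRAM.Memory),
          RealRAM.Exec P (RealRAM.inputMemory G p α) t m ∧
          (t : ℝ) ≤ ((max n 2 : ℕ) / α : ℝ) ^
            (C * Real.sqrt ((max n 2 : ℕ) / α) * Real.log ((max G.maxDegree 2 : ℕ) : ℝ)) ∧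
          ((m.output = 1 ∧ p ∈ Shearer.region G) ∨
            (m.output = 0 ∧ (1 + α) • p ∉ Shearer.region G)) := by
  refine ⟨RealRAM.shearerCode, 100, fun n G _ p α hp hα hα1 => ?_⟩
  obtain ⟨s, hs, hs'⟩ := Shearer.exists_least
    (P := fun i : ℕ => 4 * (n : ℝ) ≤ (i + 1 : ℕ) * (i + 1 : ℕ) * α) <| by
      obtain ⟨i, hi⟩ := exists_nat_ge (4 * (n : ℝ) / α)
      refine ⟨i, ?_⟩
      rw [div_le_iff₀ hα] at hi
      refine hi.trans (mul_le_mul_of_nonneg_right ?_ hα.le)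
      push_cast
      nlinarith [Nat.cast_nonneg (α := ℝ) i]
  obtain ⟨L, hL, hL'⟩ := Shearer.exists_least (P := fun i : ℕ => 4 * (n : ℝ) ≤ 2 ^ i * α) <| by
    obtain ⟨i, hi⟩ := pow_unbounded_of_one_lt (4 * (n : ℝ) / α) one_lt_two
    exact ⟨i, (div_le_iff₀ hα).1 hi.le⟩
  obtain ⟨t, m, he, ht, hm⟩ := RealRAM.runs_shearerCode (d := max G.maxDegree 2) G p
    (fun a ha S => (Shearer.card_nbr_rootedAdj_le G ha S).trans (le_max_left _ _)) hs hs' hL hL' rfl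
  refine ⟨t, m, he, ?_, ?_⟩
  · set x : ℝ := (max n 2 : ℕ) / α with hx
    have hN2 : (2 : ℝ) ≤ (max n 2 : ℕ) := by exact_mod_cast le_max_right n 2
    have hNx : ((max n 2 : ℕ) : ℝ) ≤ x := le_div_self (by linarith) hα hα1.le
    have hx2 : 2 ≤ x := hN2.trans hNx
    have hn : (n : ℝ) ≤ (max n 2 : ℕ) := by exact_mod_cast le_max_left n 2
    have hnx : (n : ℝ) ≤ x * α := by rw [hx, div_mul_cancel₀ _ hα.ne']; exact hn
    -- Needed to bound log d by log x, which absorbs the one factor d beyond d^h.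
    have hd : max G.maxDegree 2 ≤ max n 2 := by
      refine max_le_max_right _ (G.maxDegree_le_of_forall_degree_le _ fun v => ?_)
      exact (G.degree_lt_card_verts v).le.trans (by simp)
    have hdx : ((max G.maxDegree 2 : ℕ) : ℝ) ≤ x := le_trans (by exact_mod_cast hd) hNx
    have h1 := Shearer.time_le_exp hx2 (hn.trans hNx) (le_max_right G.maxDegree 2) hdx
      (Shearer.root_index_le hα hx2 hnx hs') (Shearer.log_index_le hα hx2 hnx hL') rfl
    have h2 : (t : ℝ) ≤ _ := Nat.cast_le.2 ht
    refine (h2.trans h1).trans_eq ?_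
    -- x^y = exp(y log x): the log x in the depth becomes the base x of the claimed bound.
    rw [Real.rpow_def_of_pos (by linarith)]
    congr 1
    ring
  · refine hm.imp (fun h => ⟨h.1, ?_⟩) fun h => ⟨h.1, fun hr => h.2 ?_⟩
    · refine Shearer.mem_region_of_clip_pos G hp hα hα1 (s := s + 1) (by omega) hs hL rfl
        fun a => ?_
      have h0 : ∀ v, 0 ≤ ((1 + α) • p) v := fun v => by
        have := (hp v).1
        simp only [Pi.smul_apply, smul_eq_mul]
        positivity
      -- All factors are nonnegative, so a positive product means that every single test succeeded.
      refine lt_of_le_of_ne (Shearer.clip_nonneg (h0 a)) fun e => h.2.ne' ?_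
      exact Finset.prod_eq_zero (Finset.mem_univ a) e.symm
    · exact Finset.prod_pos fun a _ => Shearer.clip_pos_of_mem_region G hr _ a
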